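/- **Setting.** Let $I$ be a finite set of users and let resources $t=1,\dots,T$ come in this order. Resource $t$ arrives independently with known probability $p_t\in[0,1]$, has capacity $c_t\in\mathbb N$, value $v_{i,t}\ge 0$ for user $i$, and success probability $q_{i,t}\in[0,1]$. When $t$ arrives, one irrevocably chooses a set $I_t$ of at most $c_t$ available users ($I_t=\emptyset$ if $t$ does not arrive); each $i\in I_t$ is successfully allocated independently with probability $q_{i,t}$ and is then no longer available. For a set $J$ let $S(J)\subseteq J$ be the random set containing each $i\in J$ independently with probability $q_{i,t}$. The social welfare is $\mathrm{SW}=\sum_t\sum_{i\in S(I_t)}v_{i,t}$. The optimal online welfare is $\mathrm{OPT}_{\mathrm{on}}=\mathrm{OPT}_{\mathrm{on}}(1,I)$, where $\mathrm{OPT}_{\mathrm{on}}(T+1,\cdot)=0$ and $$\mathrm{OPT}_{\mathrm{on}}(t,J)=(1-p_t)\,\mathrm{OPT}_{\mathrm{on}}(t+1,J)+p_t\max_{J'\subseteq J,\ |J'|\le c_t}\mathbb E\Big[\sum_{i\in S(J')}v_{i,t}+\mathrm{OPT}_{\mathrm{on}}(t+1,J\setminus S(J'))\Big].$$ **Linear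 program.** $\mathrm{LP}_{\mathrm{on}}$ is to maximize $\sum_{i,t}x_{i,t}q_{i,t}v_{i,t}$ subject to $\sum_i x_{i,t}\le p_tc_t$ for all $t$ and $0\le x_{i,t}\le p_t(1-y_{i,t})$ for all $i,t$, where $y_{i,t}:=\sum_{t'<t}x_{i,t'}q_{i,t'}$. **Pivotal sampling.** For $z\in[0,1]^I$, the random set $\mathsf{PS}(z)\subseteq I$ is produced as follows. While two coordinates are fractional, pick such a pair $i\ne j$ (by any rule) and put $a=\min(1-z_i,z_j)$, $b=\min(z_i,1-z_j)$; with probability $\frac b{a+b}$ replace $(z_i,z_j)$ by $(z_i+a,z_j-a)$, otherwise by $(z_i-b,z_j+b)$. A single remaining fractional coordinate $z_i$ is rounded to $1$ with probability $z_i$ and to $0$ otherwise. Return the set of coordinates equal to $1$. **Algorithm** (parameter $\kappa$, input a solution $x$ of $\mathrm{LP}_{\mathrm{on}}$). Put $\alpha_{i,t}=\min\big(1,\frac{0.5+\kappa}{1-(0.5+\kappa)y_{i,t}}\big)$. For each $t=1,\dots,T$, if $t$ arrives: 1. Sample $\mathsf{FP}_t=\mathsf{PS}((x_{i,t}/p_t)_i)$;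 each available $i\in\mathsf{FP}_t$ is allocated to $t$ independently with probability $\alpha_{i,t}$. Let $A_t$ be the number of users allocated to $t$ so far. 2. Sample $\mathsf{SP}_t=\mathsf{PS}\big(((1-\tfrac{A_t}{c_t})x_{i,t}/p_t)_i\big)$; each available $i\in\mathsf{SP}_t$ not yet allocated to $t$ and with $\alpha_{i,t}=1$ is allocated to $t$ independently with probability $\beta_{i,t}=\min\big(1,\frac{(0.5+\kappa)y_{i,t}-(0.5-\kappa)}{\rho_{i,t}}\big)$, where $$\rho_{i,t}=\mathbb E\Big[\mathbf 1[i\text{ available at }t\text{ and not allocated to }t\text{ in step 1}]\cdot\big(1-\tfrac{A_t}{c_t}\big)\ \Big|\ t\text{ arrived}\Big]$$ is computed exactly. Each user allocated to $t$ is then successful independently with probability $q_{i,t}$. (Quotients with zero denominator are read as $0$.) **Theorem 4.1.** Let $\kappa=0.0115$ and run the algorithm on an optimal solution $x$ of $\mathrm{LP}_{\mathrm{on}}$. Then $$\mathbb E[\mathrm{SW}]\ \ge\ (0.5+\kappa)\cdot\mathrm{OPT}_{\mathrm{on}},$$ and moreover $\Pr[i\text{ is allocated to }t]=(0.5+\kappa)\,x_{i,t}$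 for every user $i$ and every resource $t$. -/

import Mathlib

namespace CapacitatedAllocation

open scoped ENNReal

noncomputable section

/-! ### Finite probability -/

/-- Expectation of a real function on a finite sample space. -/
def expect {α : Type*} [Fintype α] (μ : PMF α) (f : α → ℝ) : ℝ :=
  ∑ a, (μ a).toReal * f a

open Classical in
/-- Probability of an event on a finite sample space. -/
def prob {α : Type*} [Fintype α] (μ : PMF α) (E : α → Prop) : ℝ :=
  expect μ fun a => if E a then 1 else 0

/-- A real number read as a probability (numbers outside `[0, 1]` are truncated to `[0, 1]`). -/
def toProb (r : ℝ) : ℝ≥0∞ := min (ENNReal.ofReal r) 1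

theorem toProb_le_one (r : ℝ) : toProb r ≤ 1 := min_le_right _ _

/-- A coin showing `true` with probability `r` (for `r ∈ [0, 1]`). -/
def coin (r : ℝ) : PMF Bool :=
  PMF.ofFintype (fun b => if b then toProb r else 1 - toProb r) (by
    simp [add_tsub_cancel_of_le (toProb_le_one r)])

/-- Independent thinning of the finite set `J`: each `i ∈ J` is kept, independently of the others,
with probability `r i`. -/
def thin {I : Type*} [DecidableEq I] (r : I → ℝ) (J : Finset I) : PMF (Finset I) :=
  PMF.ofFinset
    (fun S => if S ⊆ J then (∏ i ∈ S, toProb (r i)) * ∏ i ∈ J \ S, (1 - toProb (r i)) else 0)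
    J.powerset
    (by
      rw [Finset.sum_congr rfl (fun S hS => if_pos (Finset.mem_powerset.mp hS)),
        ← Finset.prod_add]
      exact Finset.prod_eq_one fun i _ => add_tsub_cancel_of_le (toProb_le_one (r i)))
    (fun S hS => if_neg (fun h => hS (Finset.mem_powerset.mpr h)))

/-! ### Pivotal sampling -/

section Pivotal

variable {I : Type*} [Fintype I] [DecidableEq I]

/-- The vector of marginals after moving mass `a` from coordinate `j` to coordinate `i`. -/
def shift (x : I → ℝ) (i j : I) (a : ℝ) : I → ℝ :=
  Function.update (Function.update x i (x i + a)) j (x j - a)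

/-- `IsPivotalSampling x μ`: the law `μ` of a random set is the output law of a run of pivotal
sampling (dependent rounding) on the marginals `x`.  The procedure repeatedly picks some pair
`i ≠ j` of coordinates that are both fractional, with `a = min (1 - x i) (x j)` and
`b = min (x i) (1 - x j)`, moves mass `a` from `j` to `i` with probability `b / (a + b)`, and moves
mass `b` from `i` to `j` with the complementary probability `a / (a + b)`;  a single remaining
fractional coordinate is rounded to `1` or `0` by a coin with its own value as bias;  once all
coordinates are integral, the set of coordinates equal to `1` is returned.
The order in which pairs are picked is arbitrary, and may depend on the earlier outcomes. -/
inductive IsPivotalSampling : (I → ℝ) → PMF (Finset I) → Prop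
  | done (x : I → ℝ) (hx : ∀ i, x i = 0 ∨ x i = 1) :
      IsPivotalSampling x (PMF.pure (Finset.univ.filter fun i => x i = 1))
  | last (x : I → ℝ) (i : I) (hi₀ : 0 < x i) (hi₁ : x i < 1)
      (hx : ∀ j, j ≠ i → x j = 0 ∨ x j = 1) (μ ν : PMF (Finset I))
      (hμ : IsPivotalSampling (Function.update x i 1) μ)
      (hν : IsPivotalSampling (Function.update x i 0) ν) :
      IsPivotalSampling x ((coin (x i)).bind fun up => if up then μ else ν)
  | pivot (x : I → ℝ) (i j : I) (hij : i ≠ j) (hi₀ : 0 < x i) (hi₁ : x i < 1)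
      (hj₀ : 0 < x j) (hj₁ : x j < 1) (a b : ℝ)
      (ha : a = min (1 - x i) (x j)) (hb : b = min (x i) (1 - x j)) (μ ν : PMF (Finset I))
      (hμ : IsPivotalSampling (shift x i j a) μ)
      (hν : IsPivotalSampling (shift x j i b) ν) :
      IsPivotalSampling x ((coin (b / (a + b))).bind fun up => if up then μ else ν)

/-- A pivotal sampling subroutine: for every vector of marginals in `[0, 1]` it samples a set
by pivotal sampling, following some rule for the choice of the pairs. -/
structure PivotalSampler (I : Type*) [Fintype I] [DecidableEq I] where
  /-- the law of the sampled set -/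
  sample : (I → ℝ) → PMF (Finset I)
  isPivotal : ∀ x : I → ℝ, (∀ i, 0 ≤ x i ∧ x i ≤ 1) → IsPivotalSampling x (sample x)

theorem exists_isPivotalSampling (x : I → ℝ) (hx : ∀ i, 0 ≤ x i ∧ x i ≤ 1) :
    ∃ μ, IsPivotalSampling x μ := by
  induction hn : (Finset.univ.filter fun i => 0 < x i ∧ x i < 1).card using
    Nat.strong_induction_on generalizing x with
  | _ n ih =>
    subst hn
    -- one step that keeps `[0, 1]`, creates no fractional coordinate and settles `k`
    have key : ∀ (y : I → ℝ) (k : I), (∀ l, 0 ≤ y l ∧ y l ≤ 1) →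
        (∀ l, (0 < y l ∧ y l < 1) → (0 < x l ∧ x l < 1)) → (0 < x k ∧ x k < 1) →
        ¬ (0 < y k ∧ y k < 1) → ∃ μ, IsPivotalSampling y μ := by
      intro y k hy hsub hxk hyk
      refine ih _ ?_ y hy rfl
      refine Finset.card_lt_card (Finset.ssubset_iff_of_subset ?_ |>.mpr ⟨k, ?_, ?_⟩)
      · intro l hl
        simp only [Finset.mem_filter, Finset.mem_univ, true_and] at hl ⊢
        exact hsub l hl
      · simpa using hxk
      · simpa using hyk
    have int_of : ∀ l, ¬ (0 < x l ∧ x l < 1) → x l = 0 ∨ x l = 1 := by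
      intro l hl
      rcases (hx l).1.eq_or_lt with h | h
      · exact Or.inl h.symm
      · exact Or.inr (le_antisymm (hx l).2 (not_lt.mp fun h' => hl ⟨h, h'⟩))
    by_cases h0 : ∀ l, ¬ (0 < x l ∧ x l < 1)
    · exact ⟨_, .done x fun l => int_of l (h0 l)⟩
    push Not at h0
    obtain ⟨i, hi⟩ := h0
    by_cases h1 : ∀ l, l ≠ i → ¬ (0 < x l ∧ x l < 1)
    · have h : ∀ v : ℝ, (v = 0 ∨ v = 1) → ∃ μ, IsPivotalSampling (Function.update x i v) μ := by
        intro v hv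
        refine key _ i ?_ ?_ hi ?_
        · intro l
          rcases eq_or_ne l i with rfl | hl
          · rcases hv with rfl | rfl <;> simp
          · simpa [hl] using hx l
        · intro l
          rcases eq_or_ne l i with rfl | hl
          · exact fun _ => hi
          · simp [hl]
        · rcases hv with rfl | rfl <;> simp
      obtain ⟨μ, hμ⟩ := h 1 (Or.inr rfl)
      obtain ⟨ν, hν⟩ := h 0 (Or.inl rfl)
      exact ⟨_, .last x i hi.1 hi.2 (fun l hl => int_of l (h1 l hl)) μ ν hμ hν⟩
    · push Not at h1
      obtain ⟨j, hji, hj⟩ := h1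
      have h : ∀ k l : I, k ≠ l → (0 < x k ∧ x k < 1) → (0 < x l ∧ x l < 1) →
          ∃ μ, IsPivotalSampling (shift x k l (min (1 - x k) (x l))) μ := by
        intro k l hkl hk hl
        have e1 : shift x k l (min (1 - x k) (x l)) k = x k + min (1 - x k) (x l) := by
          simp [shift, hkl]
        have e2 : shift x k l (min (1 - x k) (x l)) l = x l - min (1 - x k) (x l) := by
          simp [shift]
        have e3 : ∀ m, m ≠ k → m ≠ l → shift x k l (min (1 - x k) (x l)) m = x m := by
          intro m hm hm'
          simp [shift, hm, hm']
        have ha1 : min (1 - x k) (x l) ≤ 1 - x k := min_le_left _ _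
        have ha2 : min (1 - x k) (x l) ≤ x l := min_le_right _ _
        have ha0 : 0 < min (1 - x k) (x l) := lt_min (by linarith) hl.1
        have hbd : ∀ m, 0 ≤ shift x k l (min (1 - x k) (x l)) m ∧
            shift x k l (min (1 - x k) (x l)) m ≤ 1 := by
          intro m
          rcases eq_or_ne m k with rfl | hm
          · rw [e1]; constructor <;> linarith
          · rcases eq_or_ne m l with rfl | hm'
            · rw [e2]; constructor <;> linarith
            · rw [e3 m hm hm']; exact hx m
        have hsub : ∀ m, (0 < shift x k l (min (1 - x k) (x l)) m ∧
            shift x k l (min (1 - x k) (x l)) m < 1) → (0 < x m ∧ x m < 1) := by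
          intro m
          rcases eq_or_ne m k with rfl | hm
          · exact fun _ => hk
          · rcases eq_or_ne m l with rfl | hm'
            · exact fun _ => hl
            · rw [e3 m hm hm']; exact id
        rcases min_choice (1 - x k) (x l) with hc | hc
        · refine key _ k hbd hsub hk ?_
          rw [e1, hc]; intro h; linarith [h.2]
        · refine key _ l hbd hsub hl ?_
          rw [e2, hc]; intro h; linarith [h.1]
      obtain ⟨μ, hμ⟩ := h i j hji.symm hi hj
      obtain ⟨ν, hν⟩ := h j i hji hj hi
      refine ⟨_, .pivot x i j hji.symm hi.1 hi.2 hj.1 hj.2 _ _ rfl rfl μ ν hμ ?_⟩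
      rw [min_comm]
      exact hν

/-- Pivotal sampling subroutines exist. -/
instance : Nonempty (PivotalSampler I) := by
  classical
  exact ⟨⟨fun x => if h : ∀ i, 0 ≤ x i ∧ x i ≤ 1 then (exists_isPivotalSampling x h).choose
      else PMF.pure ∅,
    fun x h => by
      rw [dif_pos h]
      exact (exists_isPivotalSampling x h).choose_spec⟩⟩

end Pivotal

/-! ### The problem, the optimal online algorithm and the linear program -/

/-- An instance of online capacitated allocation with Bernoulli arrivals and stochastic rewards:
users `I` and resources `0, …, T - 1` in order of arrival. -/
structure Problem (I : Type*) (T : ℕ) where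
  /-- arrival probability of resource `t` -/
  p : Fin T → ℝ
  /-- capacity of resource `t` -/
  c : Fin T → ℕ
  /-- value of user `i` for resource `t` -/
  v : I → Fin T → ℝ
  /-- success probability of the pair `(i, t)` -/
  q : I → Fin T → ℝ
  p_nonneg : ∀ t, 0 ≤ p t
  p_le_one : ∀ t, p t ≤ 1
  v_nonneg : ∀ i t, 0 ≤ v i t
  q_nonneg : ∀ i t, 0 ≤ q i t
  q_le_one : ∀ i t, q i t ≤ 1

namespace Problem

variable {I : Type*} {T : ℕ} (P : Problem I T)

/-- The choices for resource `t` when the users in `J` are available: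
the subsets of `J` of size at most `c t`. -/
def choices (t : Fin T) (J : Finset I) : Finset (Finset I) :=
  J.powerset.filter fun J' => J'.card ≤ P.c t

theorem choices_nonempty (t : Fin T) (J : Finset I) : (P.choices t J).Nonempty :=
  ⟨∅, by simp [choices]⟩

variable [Fintype I] [DecidableEq I]

/-- The optimum expected gain of an online algorithm from the resources `t, t + 1, …` when the
users in `J` are available (Bellman equation; no gain is left once all resources are over). -/
def optFrom (t : ℕ) (J : Finset I) : ℝ :=
  if h : t < T then
    (1 - P.p ⟨t, h⟩) * optFrom (t + 1) J +
      P.p ⟨t, h⟩ * (P.choices ⟨t, h⟩ J).sup' (P.choices_nonempty ⟨t, h⟩ J) fun J' =>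
        expect (thin (fun i => P.q i ⟨t, h⟩) J') fun S =>
          (∑ i ∈ S, P.v i ⟨t, h⟩) + optFrom (t + 1) (J \ S)
  else 0
termination_by T - t

/-- The expected social welfare of the optimal online algorithm. -/
def optOn : ℝ := P.optFrom 0 Finset.univ

/-- `y i t = ∑_{t' < t} x i t' * q i t'`. -/
def load (x : I → Fin T → ℝ) (i : I) (t : Fin T) : ℝ :=
  ∑ t' ∈ Finset.Iio t, x i t' * P.q i t'

/-- Feasibility for the linear program. -/
def LPFeasible (x : I → Fin T → ℝ) : Prop :=
  (∀ t, ∑ i, x i t ≤ P.p t * P.c t) ∧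
    ∀ i t, 0 ≤ x i t ∧ x i t ≤ P.p t * (1 - P.load x i t)

/-- The objective of the linear program. -/
def lpValue (x : I → Fin T → ℝ) : ℝ :=
  ∑ i, ∑ t, x i t * P.q i t * P.v i t

/-- `x` is an optimal solution of the linear program. -/
def LPOptimal (x : I → Fin T → ℝ) : Prop :=
  P.LPFeasible x ∧ ∀ x', P.LPFeasible x' → P.lpValue x' ≤ P.lpValue x

end Problem

/-! ### The two-proposal algorithm -/

/-- The record of a run: for each resource the set of users allocated to it and the set of users
successfully allocated to it (both empty if the resource did not arrive or has not come yet). -/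
abbrev History (I : Type*) (T : ℕ) : Type _ := Fin T → Finset I × Finset I

namespace Algorithm

variable {I : Type*} [Fintype I] [DecidableEq I] {T : ℕ}

/-- The users available at `t`: those not successfully allocated to an earlier resource. -/
def avail (h : History I T) (t : Fin T) : Finset I :=
  Finset.univ.filter fun i => ∀ t' < t, i ∉ (h t').2

/-- The acceptance probability of a first proposal. -/
def alpha (P : Problem I T) (κ : ℝ) (x : I → Fin T → ℝ) (i : I) (t : Fin T) : ℝ :=
  min 1 ((0.5 + κ) / (1 - (0.5 + κ) * P.load x i t))

/-- The law of the set of users allocated along a first proposal when `t` arrives, given the past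
`h`: a pivotal sample with marginals `x i t / p t`, whose available members accept independently
with probability `alpha`. -/
def firstAlloc (P : Problem I T) (PS : PivotalSampler I) (κ : ℝ) (x : I → Fin T → ℝ)
    (h : History I T) (t : Fin T) : PMF (Finset I) :=
  (PS.sample fun i => x i t / P.p t).bind fun FP =>
    thin (fun i => alpha P κ x i t) (FP ∩ avail h t)

/-- The expectation `ρ i t`, where `D` is the law of the history before `t`: the expectation, given
that `t` arrives, of `1 - A / c t` on the event that `i` is available and unallocated after the
first proposals, where `A` is the number of users allocated along first proposals.
(The arrival of `t` is independent of the history before `t`.) -/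
def rho (P : Problem I T) (PS : PivotalSampler I) (κ : ℝ) (x : I → Fin T → ℝ)
    (D : PMF (History I T)) (i : I) (t : Fin T) : ℝ :=
  expect D fun h => expect (firstAlloc P PS κ x h t) fun A =>
    if i ∈ avail h t ∧ i ∉ A then 1 - (A.card : ℝ) / P.c t else 0

/-- The acceptance probability of a second proposal. -/
def beta (P : Problem I T) (PS : PivotalSampler I) (κ : ℝ) (x : I → Fin T → ℝ)
    (D : PMF (History I T)) (i : I) (t : Fin T) : ℝ :=
  min 1 (((0.5 + κ) * P.load x i t - (0.5 - κ)) * (1 / rho P PS κ x D i t))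

open Classical in
/-- The law of the set of users allocated along a second proposal when `t` arrives, given the past
`h` and the set `A` allocated along first proposals: a pivotal sample with marginals
`(1 - |A| / c t) * x i t / p t`, whose members `i` that are available, not yet allocated to `t`,
and have `alpha = 1` accept independently with probability `beta`. -/
def secondAlloc (P : Problem I T) (PS : PivotalSampler I) (κ : ℝ) (x : I → Fin T → ℝ)
    (D : PMF (History I T)) (h : History I T) (t : Fin T) (A : Finset I) : PMF (Finset I) :=
  (PS.sample fun i => (1 - (A.card : ℝ) / P.c t) * x i t / P.p t).bind fun SP =>
    thin (fun i => beta P PS κ x D i t)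
      (((SP ∩ avail h t) \ A).filter fun i => alpha P κ x i t = 1)

/-- The round of a resource `t` that arrives: first proposals, second proposals, then each
allocated user is successful independently with probability `q i t`. -/
def arrivalRound (P : Problem I T) (PS : PivotalSampler I) (κ : ℝ) (x : I → Fin T → ℝ)
    (D : PMF (History I T)) (h : History I T) (t : Fin T) : PMF (History I T) :=
  (firstAlloc P PS κ x h t).bind fun A =>
    (secondAlloc P PS κ x D h t A).bind fun B =>
      (thin (fun i => P.q i t) (A ∪ B)).bind fun S =>
        PMF.pure (Function.update h t (A ∪ B, S))

/-- The law of the history of the algorithm after the first `t` rounds (of `T` rounds). -/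
def run (P : Problem I T) (PS : PivotalSampler I) (κ : ℝ) (x : I → Fin T → ℝ) :
    ℕ → PMF (History I T)
  | 0 => PMF.pure fun _ => (∅, ∅)
  | t + 1 =>
    if ht : t < T then
      (run P PS κ x t).bind fun h => (coin (P.p ⟨t, ht⟩)).bind fun arrives =>
        if arrives then arrivalRound P PS κ x (run P PS κ x t) h ⟨t, ht⟩ else PMF.pure h
    else run P PS κ x t

/-- The probability that the algorithm allocates user `i` to resource `t`. -/
def allocProb (P : Problem I T) (PS : PivotalSampler I) (κ : ℝ) (x : I → Fin T → ℝ)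
    (i : I) (t : Fin T) : ℝ :=
  prob (run P PS κ x T) fun h => i ∈ (h t).1

/-- The expected social welfare of the algorithm: the expected total value of the successful
allocations. -/
def expectedWelfare (P : Problem I T) (PS : PivotalSampler I) (κ : ℝ) (x : I → Fin T → ℝ) : ℝ :=
  expect (run P PS κ x T) fun h => ∑ t, ∑ i ∈ (h t).2, P.v i t

end Algorithm

end

end CapacitatedAllocation

/-! Two facts give the theorem. The linear program dominates the optimal online algorithm: the
probabilities `optMarginal` with which that algorithm picks `i` for `t` form a feasible solution
whose value is `optOn`. And the two-proposal algorithm allocates each pair with probability exactly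
`0.5115 * x i t`, so by linearity its welfare is `0.5115 * lpValue x`.

The exact allocation probability is proved by induction over time together with `Pr[i available at
t] = 1 - 0.5115 y`, where `y` is the load (`expect_alloc_of_avail`, `expect_avail`). If `alpha < 1`,
first proposals alone hit the target. If `alpha = 1`, they fall short by `(0.5115 y - 0.4885) x`,
and second proposals add `beta * rho * x`. So everything rests on `rho ≥ 0.5115 y - 0.4885`, which
keeps `beta` from being truncated at `1`.

The bound on `rho` is `le_rho`. Fix a pivotal sample `F` that misses `i`. Each `j ∈ F` uses a
fraction `1 / c` of the capacity while `i` is available, with probability `alpha_j * Pr[i, j both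
available]`. As `|F| ≤ c`, a uniform bound `M` on these products costs at most `M` in total. The
constant `M = 0.4` suffices.

Joint availability is bounded without using the induction. Pivotal sampling makes first proposals
pairwise negatively correlated, and second proposals only remove more users, so each round shrinks
`Pr[i, j available]` at least as much as independent proposals would. Cauchy–Schwarz over the shared
arrival coin splits the square of this bound into one factor per user, and each product of factors
stays below `1 - 0.65 y` (`joint_sq_le`). With `alpha_i = 1`, `sq_mul_le` for both users gives
`0.4`. -/

namespace CapacitatedAllocation

open scoped ENNReal

noncomputable section

/-! ### Expectation calculus on finite sample spaces -/

section Expectation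

variable {α β : Type*} [Fintype α] [Fintype β]

theorem expect_bind (μ : PMF α) (k : α → PMF β) (f : β → ℝ) :
    expect (μ.bind k) f = expect μ fun a => expect (k a) f := by
  simp only [expect, PMF.bind_apply, tsum_fintype]
  simp_rw [Finset.mul_sum]
  rw [Finset.sum_comm]
  refine Finset.sum_congr rfl fun b _ => ?_
  rw [ENNReal.toReal_sum fun a _ =>
    ENNReal.mul_ne_top (PMF.apply_ne_top _ _) (PMF.apply_ne_top _ _), Finset.sum_mul]
  simp [ENNReal.toReal_mul, mul_assoc]

theorem expect_pure (a : α) (f : α → ℝ) : expect (PMF.pure a) f = f a := by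
  classical
  simp only [expect, PMF.pure_apply]
  rw [Finset.sum_eq_single a] <;> simp +contextual

theorem sum_toReal (μ : PMF α) : ∑ a, (μ a).toReal = 1 := by
  rw [← ENNReal.toReal_sum fun a _ => PMF.apply_ne_top _ _, ← tsum_fintype (L := .unconditional α), μ.tsum_coe]
  simp

theorem expect_const (μ : PMF α) (r : ℝ) : expect μ (fun _ => r) = r := by
  simp [expect, ← Finset.sum_mul, sum_toReal]

theorem expect_add (μ : PMF α) (f g : α → ℝ) :
    expect μ (fun a => f a + g a) = expect μ f + expect μ g := by
  simp [expect, mul_add, Finset.sum_add_distrib]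

theorem expect_sub (μ : PMF α) (f g : α → ℝ) :
    expect μ (fun a => f a - g a) = expect μ f - expect μ g := by
  simp [expect, mul_sub, Finset.sum_sub_distrib]

theorem expect_mul_left (μ : PMF α) (r : ℝ) (f : α → ℝ) :
    expect μ (fun a => r * f a) = r * expect μ f := by
  simp only [expect, Finset.mul_sum]
  exact Finset.sum_congr rfl fun a _ => by ring

theorem expect_mul_right (μ : PMF α) (r : ℝ) (f : α → ℝ) :
    expect μ (fun a => f a * r) = expect μ f * r := by
  simp only [expect, Finset.sum_mul, mul_assoc]

theorem expect_sum {ι : Type*} (μ : PMF α) (s : Finset ι) (f : ι → α → ℝ) :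
    expect μ (fun a => ∑ i ∈ s, f i a) = ∑ i ∈ s, expect μ (f i) := by
  simp only [expect, Finset.mul_sum]
  exact Finset.sum_comm

theorem expect_comm (μ : PMF α) (ν : PMF β) (f : α → β → ℝ) :
    (expect μ fun a => expect ν (f a)) = expect ν fun b => expect μ fun a => f a b := by
  simp only [expect, Finset.mul_sum]
  rw [Finset.sum_comm]
  exact Finset.sum_congr rfl fun a _ => Finset.sum_congr rfl fun b _ => by ring

theorem expect_mono {μ : PMF α} {f g : α → ℝ} (h : ∀ a ∈ μ.support, f a ≤ g a) :
    expect μ f ≤ expect μ g := by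
  refine Finset.sum_le_sum fun a _ => ?_
  by_cases ha : a ∈ μ.support
  · exact mul_le_mul_of_nonneg_left (h a ha) ENNReal.toReal_nonneg
  · simp [(PMF.apply_eq_zero_iff μ a).2 ha]

theorem expect_congr {μ : PMF α} {f g : α → ℝ} (h : ∀ a ∈ μ.support, f a = g a) :
    expect μ f = expect μ g :=
  le_antisymm (expect_mono fun a ha => (h a ha).le) (expect_mono fun a ha => (h a ha).ge)

theorem expect_nonneg {μ : PMF α} {f : α → ℝ} (h : ∀ a, 0 ≤ f a) : 0 ≤ expect μ f :=
  Finset.sum_nonneg fun a _ => mul_nonneg ENNReal.toReal_nonneg (h a)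

theorem toReal_toProb {r : ℝ} (h0 : 0 ≤ r) (h1 : r ≤ 1) : (toProb r).toReal = r := by
  rw [toProb, min_eq_left (by simpa using h1), ENNReal.toReal_ofReal h0]

theorem toReal_one_sub_toProb {r : ℝ} (h0 : 0 ≤ r) (h1 : r ≤ 1) :
    (1 - toProb r).toReal = 1 - r := by
  rw [ENNReal.toReal_sub_of_le (toProb_le_one r) (by simp), toReal_toProb h0 h1]
  simp

theorem expect_coin {r : ℝ} (h0 : 0 ≤ r) (h1 : r ≤ 1) (f : Bool → ℝ) :
    expect (coin r) f = r * f true + (1 - r) * f false := by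
  simp [expect, coin, toReal_toProb h0 h1, toReal_one_sub_toProb h0 h1]

end Expectation

/-! ### Independent thinning: inclusion of one and two elements -/

section Thinning

variable {I : Type*} [DecidableEq I]

theorem subset_of_mem_support_thin {r : I → ℝ} {J S : Finset I} (h : S ∈ (thin r J).support) :
    S ⊆ J := by
  by_contra hS
  exact h (by simp [thin, PMF.ofFinset_apply, hS])

variable [Fintype I]

/-- This is the generating function of the thinned set, obtained by expanding the right-hand
product. Setting `f` to `0` at chosen points and `1` elsewhere yields the avoidance probabilities
below. -/
theorem expect_thin_prod {r : I → ℝ} (J : Finset I) (h0 : ∀ i ∈ J, 0 ≤ r i)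
    (h1 : ∀ i ∈ J, r i ≤ 1) (f : I → ℝ) :
    (expect (thin r J) fun S => ∏ i ∈ S, f i) = ∏ i ∈ J, (r i * f i + (1 - r i)) := by
  rw [Finset.prod_add, expect, ← Finset.sum_subset (Finset.subset_univ J.powerset)]
  · refine Finset.sum_congr rfl fun S hS => ?_
    rw [thin, PMF.ofFinset_apply, if_pos (Finset.mem_powerset.1 hS), ENNReal.toReal_mul,
      ENNReal.toReal_prod, ENNReal.toReal_prod, Finset.prod_mul_distrib]
    rw [Finset.prod_congr rfl fun i hi => toReal_toProb (h0 i (Finset.mem_powerset.1 hS hi))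
        (h1 i (Finset.mem_powerset.1 hS hi)),
      Finset.prod_congr rfl fun i hi => toReal_one_sub_toProb (h0 i (Finset.mem_sdiff.1 hi).1)
        (h1 i (Finset.mem_sdiff.1 hi).1)]
    ring
  · intro S _ hS
    rw [thin, PMF.ofFinset_apply, if_neg (fun h => hS (Finset.mem_powerset.2 h))]
    simp

theorem expect_thin_notMem {r : I → ℝ} (J : Finset I) (h0 : ∀ i ∈ J, 0 ≤ r i)
    (h1 : ∀ i ∈ J, r i ≤ 1) (i : I) :
    (expect (thin r J) fun S => if i ∈ S then 0 else 1) = 1 - if i ∈ J then r i else 0 := by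
  have h := expect_thin_prod J h0 h1 fun k => if k = i then 0 else 1
  have e : ∀ S : Finset I, (∏ k ∈ S, if k = i then (0 : ℝ) else 1) = if i ∈ S then 0 else 1 := by
    intro S
    split_ifs with hi
    · exact Finset.prod_eq_zero hi (by simp)
    · exact Finset.prod_eq_one fun k hk => by
        rw [if_neg]; rintro rfl; exact hi hk
  simp only [e] at h
  rw [h]
  have e2 : ∀ k ∈ J, (r k * (if k = i then (0 : ℝ) else 1) + (1 - r k)) =
      if k = i then 1 - r k else 1 := by
    intro k _; split_ifs <;> ring
  rw [Finset.prod_congr rfl e2, Finset.prod_ite_eq']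
  split_ifs <;> ring

theorem expect_thin_mem {r : I → ℝ} (J : Finset I) (h0 : ∀ i ∈ J, 0 ≤ r i)
    (h1 : ∀ i ∈ J, r i ≤ 1) (i : I) :
    (expect (thin r J) fun S => if i ∈ S then 1 else 0) = if i ∈ J then r i else 0 := by
  have h := expect_thin_notMem J h0 h1 i
  have e : (fun S : Finset I => if i ∈ S then (0 : ℝ) else 1) =
      fun S => 1 - if i ∈ S then 1 else 0 := by
    funext S; split_ifs <;> ring
  rw [e, expect_sub, expect_const] at h
  linarith

theorem expect_thin_notMem_notMem {r : I → ℝ} (J : Finset I) (h0 : ∀ i ∈ J, 0 ≤ r i)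
    (h1 : ∀ i ∈ J, r i ≤ 1) {i j : I} (hij : i ≠ j) :
    (expect (thin r J) fun S => (if i ∈ S then 0 else 1) * if j ∈ S then 0 else 1) =
      (1 - if i ∈ J then r i else 0) * (1 - if j ∈ J then r j else 0) := by
  have h := expect_thin_prod J h0 h1 fun k => (if k = i then 0 else 1) * if k = j then 0 else 1
  have e : ∀ (l : I) (S : Finset I),
      (∏ k ∈ S, if k = l then (0 : ℝ) else 1) = if l ∈ S then 0 else 1 := by
    intro l S
    split_ifs with hi
    · exact Finset.prod_eq_zero hi (by simp)
    · exact Finset.prod_eq_one fun k hk => by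
        rw [if_neg]; rintro rfl; exact hi hk
  simp only [Finset.prod_mul_distrib, e] at h
  rw [h]
  have e2 : ∀ k ∈ J, (r k * ((if k = i then (0 : ℝ) else 1) * if k = j then 0 else 1) +
      (1 - r k)) = (if k = i then 1 - r k else 1) * if k = j then 1 - r k else 1 := by
    intro k _
    by_cases hki : k = i
    · subst hki; simp [hij]
    · simp only [hki, if_false]; split_ifs <;> ring
  rw [Finset.prod_congr rfl e2, Finset.prod_mul_distrib, Finset.prod_ite_eq', Finset.prod_ite_eq']
  split_ifs <;> ring

theorem expect_thin_notMem_mem {r : I → ℝ} (J : Finset I) (h0 : ∀ i ∈ J, 0 ≤ r i)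
    (h1 : ∀ i ∈ J, r i ≤ 1) {i j : I} (hij : i ≠ j) :
    (expect (thin r J) fun S => (if i ∈ S then 0 else 1) * if j ∈ S then 1 else 0) =
      (1 - if i ∈ J then r i else 0) * if j ∈ J then r j else 0 := by
  have e : (fun S : Finset I => (if i ∈ S then (0 : ℝ) else 1) * if j ∈ S then 1 else 0) =
      fun S => (if i ∈ S then 0 else 1) - (if i ∈ S then 0 else 1) * if j ∈ S then 0 else 1 := by
    funext S; split_ifs <;> ring
  rw [e, expect_sub, expect_thin_notMem J h0 h1, expect_thin_notMem_notMem J h0 h1 hij]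
  ring

end Thinning

/-! ### Pivotal sampling: marginals, negative correlation, cardinality -/

section PivotalProperties

theorem pivot_step {I : Type*} {x : I → ℝ} {i j : I} (hi₀ : 0 < x i) (hi₁ : x i < 1) (hj₀ : 0 < x j)
    (hj₁ : x j < 1) {a b : ℝ} (ha : a = min (1 - x i) (x j)) (hb : b = min (x i) (1 - x j)) :
    0 < a ∧ 0 < b ∧ a ≤ 1 - x i ∧ a ≤ x j ∧ b ≤ x i ∧ b ≤ 1 - x j ∧
      0 ≤ b / (a + b) ∧ b / (a + b) ≤ 1 := by
  have ha0 : 0 < a := by rw [ha]; exact lt_min (by linarith) hj₀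
  have hb0 : 0 < b := by rw [hb]; exact lt_min hi₀ (by linarith)
  refine ⟨ha0, hb0, ha ▸ min_le_left _ _, ha ▸ min_le_right _ _, hb ▸ min_le_left _ _,
    hb ▸ min_le_right _ _, by positivity, ?_⟩
  rw [div_le_one (by positivity)]; linarith

variable {I : Type*} [DecidableEq I]

theorem shift_left {x : I → ℝ} {i j : I} (hij : i ≠ j) (a : ℝ) : shift x i j a i = x i + a := by
  simp [shift, hij]

theorem shift_right (x : I → ℝ) (i j : I) (a : ℝ) : shift x i j a j = x j - a := by
  simp [shift]

theorem shift_other {x : I → ℝ} {i j k : I} (a : ℝ) (hi : k ≠ i) (hj : k ≠ j) :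
    shift x i j a k = x k := by
  simp [shift, hi, hj]

theorem shift_mem_Icc {x : I → ℝ} (hx : ∀ k, 0 ≤ x k ∧ x k ≤ 1) {i j : I} (hij : i ≠ j)
    {a : ℝ} (h0 : 0 ≤ a) (hi : a ≤ 1 - x i) (hj : a ≤ x j) (k : I) :
    0 ≤ shift x i j a k ∧ shift x i j a k ≤ 1 := by
  by_cases hki : k = i
  · subst hki; rw [shift_left hij]; constructor <;> linarith [hx k]
  · by_cases hkj : k = j
    · subst hkj; rw [shift_right]; constructor <;> linarith [hx k]
    · rw [shift_other a hki hkj]; exact hx k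

theorem update_mem_Icc {x : I → ℝ} (hx : ∀ k, 0 ≤ x k ∧ x k ≤ 1) (i : I) {v : ℝ}
    (h0 : 0 ≤ v) (h1 : v ≤ 1) (k : I) :
    0 ≤ Function.update x i v k ∧ Function.update x i v k ≤ 1 := by
  by_cases h : k = i
  · subst h; simp [h0, h1]
  · simp [h, hx k]

variable [Fintype I]

theorem sum_shift (x : I → ℝ) {i j : I} (hij : i ≠ j) (a : ℝ) :
    ∑ k, shift x i j a k = ∑ k, x k := by
  have e : ∀ k, shift x i j a k = x k + ((if k = i then a else 0) - if k = j then a else 0) := by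
    intro k
    by_cases hki : k = i
    · subst hki; simp [shift_left hij, hij]
    · by_cases hkj : k = j
      · subst hkj; simp [shift_right, hki, sub_eq_add_neg]
      · simp [shift_other a hki hkj, hki, hkj]
  simp [e, Finset.sum_add_distrib]

theorem expect_coin_bind {α : Type*} [Fintype α] {r : ℝ} (h0 : 0 ≤ r) (h1 : r ≤ 1)
    (μ ν : PMF α) (f : α → ℝ) :
    expect ((coin r).bind fun up => if up then μ else ν) f =
      r * expect μ f + (1 - r) * expect ν f := by
  rw [expect_bind, expect_coin h0 h1]; simp

/-- The coin biases make every coordinate a martingale along the run. -/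
theorem IsPivotalSampling.expect_mem {x : I → ℝ} {μ : PMF (Finset I)}
    (h : IsPivotalSampling x μ) (hx : ∀ k, 0 ≤ x k ∧ x k ≤ 1) (k : I) :
    (expect μ fun F => if k ∈ F then 1 else 0) = x k := by
  induction h with
  | done x hx' =>
    rw [expect_pure]
    rcases hx' k with h | h <;> simp [h]
  | last x i hi₀ hi₁ hx' μ ν hμ hν ihμ ihν =>
    rw [expect_coin_bind hi₀.le hi₁.le, ihμ (update_mem_Icc hx i zero_le_one le_rfl),
      ihν (update_mem_Icc hx i le_rfl zero_le_one)]
    by_cases hk : k = i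
    · subst hk; simp
    · simp only [Function.update_of_ne hk]; ring
  | pivot x i j hij hi₀ hi₁ hj₀ hj₁ a b ha hb μ ν hμ hν ihμ ihν =>
    obtain ⟨ha0, hb0, ha1, ha2, hb1, hb2, hq0, hq1⟩ := pivot_step hi₀ hi₁ hj₀ hj₁ ha hb
    rw [expect_coin_bind hq0 hq1, ihμ (shift_mem_Icc hx hij ha0.le ha1 ha2),
      ihν (shift_mem_Icc hx hij.symm hb0.le hb2 hb1)]
    by_cases hki : k = i
    · subst hki
      rw [shift_left hij, shift_right]
      field_simp; ring
    · by_cases hkj : k = j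
      · subst hkj
        rw [shift_left hij.symm, shift_right]
        field_simp; ring
      · rw [shift_other _ hki hkj, shift_other _ hkj hki]; ring

/-- The product of two coordinates is a supermartingale. A pivot on exactly these two lowers its
mean by `a * b`; a step that changes at most one of them preserves the mean. -/
theorem IsPivotalSampling.expect_mem_mul_mem_le {x : I → ℝ} {μ : PMF (Finset I)}
    (h : IsPivotalSampling x μ) (hx : ∀ k, 0 ≤ x k ∧ x k ≤ 1) {k l : I} (hkl : k ≠ l) :
    (expect μ fun F => (if k ∈ F then 1 else 0) * if l ∈ F then 1 else 0) ≤ x k * x l := by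
  induction h with
  | done x hx' =>
    rw [expect_pure]
    rcases hx' k with h | h <;> rcases hx' l with h' | h' <;> simp [h, h']
  | last x i hi₀ hi₁ hx' μ ν hμ hν ihμ ihν =>
    rw [expect_coin_bind hi₀.le hi₁.le]
    have h1 := mul_le_mul_of_nonneg_left (ihμ (update_mem_Icc hx i zero_le_one le_rfl)) hi₀.le
    have h2 := mul_le_mul_of_nonneg_left (ihν (update_mem_Icc hx i le_rfl zero_le_one))
      (sub_nonneg.2 hi₁.le)
    refine (add_le_add h1 h2).trans (le_of_eq ?_)
    by_cases hk : k = i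
    · subst hk; simp [hkl.symm]
    · by_cases hl : l = i
      · subst hl; simp [hkl, mul_comm]
      · simp only [Function.update_of_ne hk, Function.update_of_ne hl]; ring
  | pivot x i j hij hi₀ hi₁ hj₀ hj₁ a b ha hb μ ν hμ hν ihμ ihν =>
    obtain ⟨ha0, hb0, ha1, ha2, hb1, hb2, hq0, hq1⟩ := pivot_step hi₀ hi₁ hj₀ hj₁ ha hb
    rw [expect_coin_bind hq0 hq1]
    have h1 := mul_le_mul_of_nonneg_left (ihμ (shift_mem_Icc hx hij ha0.le ha1 ha2)) hq0
    have h2 := mul_le_mul_of_nonneg_left (ihν (shift_mem_Icc hx hij.symm hb0.le hb2 hb1))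
      (sub_nonneg.2 hq1)
    refine (add_le_add h1 h2).trans ?_
    have key : b / (a + b) * ((x i + a) * (x j - a)) +
        (1 - b / (a + b)) * ((x i - b) * (x j + b)) = x i * x j - a * b := by
      field_simp; ring
    have hab : 0 < a * b := mul_pos ha0 hb0
    -- If only one of the two tracked coordinates moves, the product is linear in it and the mean is
    -- unchanged.
    have lin : ∀ u v w : ℝ, b / (a + b) * ((u + a) * w) + (1 - b / (a + b)) * ((u - b) * w) =
        u * w := by
      intro u v w; field_simp; ring
    have lin' : ∀ u v w : ℝ, b / (a + b) * ((u - a) * w) + (1 - b / (a + b)) * ((u + b) * w) =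
        u * w := by
      intro u v w; field_simp; ring
    by_cases hki : k = i
    · subst hki
      rw [shift_left hij, shift_right]
      by_cases hlj : l = j
      · subst hlj
        rw [shift_left hij.symm, shift_right, key]; linarith
      · rw [shift_other _ hkl.symm hlj, shift_other _ hlj hkl.symm, lin _ 0]
    · by_cases hkj : k = j
      · subst hkj
        rw [shift_left hij.symm, shift_right]
        by_cases hli : l = i
        · subst hli
          rw [shift_left hij, shift_right, mul_comm (x k - a), mul_comm (x k + b), key]
          linarith
        · rw [shift_other _ hkl.symm hli, shift_other _ hli hkl.symm, lin' _ 0]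
      · rw [shift_other _ hki hkj, shift_other _ hkj hki]
        by_cases hli : l = i
        · subst hli
          rw [shift_left hij, shift_right, mul_comm (x k), mul_comm (x k), mul_comm (x k), lin _ 0]
        · by_cases hlj : l = j
          · subst hlj
            rw [shift_left hij.symm, shift_right, mul_comm (x k), mul_comm (x k), mul_comm (x k),
              lin' _ 0]
          · rw [shift_other _ hli hlj, shift_other _ hlj hli]
            exact le_of_eq (by ring)

theorem mem_support_coin_bind {α : Type*} {r : ℝ} {μ ν : PMF α} {a : α}
    (h : a ∈ ((coin r).bind fun up => if up then μ else ν).support) :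
    a ∈ μ.support ∨ a ∈ ν.support := by
  rw [PMF.mem_support_bind_iff] at h
  obtain ⟨b, -, hb⟩ := h
  cases b
  · exact Or.inr (by simpa using hb)
  · exact Or.inl (by simpa using hb)

/-- Pivots conserve the total mass, so only the final rounding can exceed it. It does not pass the
next integer, hence not `c`. -/
theorem IsPivotalSampling.card_le {x : I → ℝ} {μ : PMF (Finset I)}
    (h : IsPivotalSampling x μ) (hx : ∀ k, 0 ≤ x k ∧ x k ≤ 1) {c : ℕ} (hc : ∑ k, x k ≤ c)
    {F : Finset I} (hF : F ∈ μ.support) : F.card ≤ c := by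
  induction h with
  | done x hx' =>
    rw [PMF.support_pure, Set.mem_singleton_iff] at hF
    subst hF
    have e : ∑ k, x k = ∑ k, if x k = 1 then (1 : ℝ) else 0 :=
      Finset.sum_congr rfl fun k _ => by rcases hx' k with h | h <;> simp [h]
    rw [e, Finset.sum_boole] at hc
    exact_mod_cast hc
  | last x i hi₀ hi₁ hx' μ ν hμ hν ihμ ihν =>
    rcases mem_support_coin_bind hF with hF | hF
    · refine ihμ (update_mem_Icc hx i zero_le_one le_rfl) ?_ hF
      rw [Finset.sum_update_of_mem (Finset.mem_univ _), Finset.sdiff_singleton_eq_erase]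
      rw [← Finset.add_sum_erase _ x (Finset.mem_univ i)] at hc
      have e : ∑ k ∈ Finset.univ.erase i, x k =
          ∑ k ∈ Finset.univ.erase i, if x k = 1 then (1 : ℝ) else 0 :=
        Finset.sum_congr rfl fun k hk => by
          rcases hx' k (Finset.ne_of_mem_erase hk) with h | h <;> simp [h]
      rw [e, Finset.sum_boole] at hc ⊢
      -- The remaining fractional mass is positive, so the count of ones is strictly below the
      -- integer `c`, and one more fits.
      have : ((((Finset.univ.erase i).filter fun k => x k = 1).card : ℕ) : ℝ) < c := by linarith
      have : (((Finset.univ.erase i).filter fun k => x k = 1).card : ℕ) < c := by exact_mod_cast this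
      have : 1 + ((Finset.univ.erase i).filter fun k => x k = 1).card ≤ c := by omega
      exact_mod_cast this
    · refine ihν (update_mem_Icc hx i le_rfl zero_le_one) ?_ hF
      rw [Finset.sum_update_of_mem (Finset.mem_univ _), Finset.sdiff_singleton_eq_erase]
      rw [← Finset.add_sum_erase _ x (Finset.mem_univ i)] at hc
      linarith
  | pivot x i j hij hi₀ hi₁ hj₀ hj₁ a b ha hb μ ν hμ hν ihμ ihν =>
    obtain ⟨ha0, hb0, ha1, ha2, hb1, hb2, hq0, hq1⟩ := pivot_step hi₀ hi₁ hj₀ hj₁ ha hb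
    rcases mem_support_coin_bind hF with hF | hF
    · exact ihμ (shift_mem_Icc hx hij ha0.le ha1 ha2) (by rwa [sum_shift x hij]) hF
    · exact ihν (shift_mem_Icc hx hij.symm hb0.le hb2 hb1) (by rwa [sum_shift x hij.symm]) hF

end PivotalProperties

section ThinningPairs

variable {I : Type*} [Fintype I] [DecidableEq I]

theorem expect_thin_mem_mem {r : I → ℝ} (J : Finset I) (h0 : ∀ i ∈ J, 0 ≤ r i)
    (h1 : ∀ i ∈ J, r i ≤ 1) {i j : I} (hij : i ≠ j) :
    (expect (thin r J) fun S => (if i ∈ S then 1 else 0) * if j ∈ S then 1 else 0) =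
      (if i ∈ J then r i else 0) * if j ∈ J then r j else 0 := by
  have e : (fun S : Finset I => (if i ∈ S then (1 : ℝ) else 0) * if j ∈ S then 1 else 0) =
      fun S => (if j ∈ S then 1 else 0) - (if i ∈ S then 0 else 1) * if j ∈ S then 1 else 0 := by
    funext S; split_ifs <;> ring
  rw [e, expect_sub, expect_thin_mem J h0 h1, expect_thin_notMem_mem J h0 h1 hij]
  ring

end ThinningPairs

/-! ### Consequences of LP feasibility -/

namespace Problem

variable {I : Type*} {T : ℕ} (P : Problem I T)

/-- The load of user `i` from the first `n` resources. -/
def loadBefore (x : I → Fin T → ℝ) (i : I) (n : ℕ) : ℝ :=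
  ∑ t' ∈ Finset.univ.filter fun t' : Fin T => (t' : ℕ) < n, x i t' * P.q i t'

theorem load_eq_loadBefore (x : I → Fin T → ℝ) (i : I) (t : Fin T) :
    P.load x i t = P.loadBefore x i t := by
  unfold load loadBefore
  congr 1
  ext t'
  simp

theorem loadBefore_zero (x : I → Fin T → ℝ) (i : I) : P.loadBefore x i 0 = 0 := by
  simp [loadBefore]

theorem loadBefore_succ (x : I → Fin T → ℝ) (i : I) (t : Fin T) :
    P.loadBefore x i (t + 1) = P.loadBefore x i t + x i t * P.q i t := by
  unfold loadBefore
  have e : (Finset.univ.filter fun t' : Fin T => (t' : ℕ) < t + 1) =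
      insert t (Finset.univ.filter fun t' : Fin T => (t' : ℕ) < t) := by
    ext t'
    simp only [Finset.mem_filter, Finset.mem_univ, true_and, Finset.mem_insert, Fin.ext_iff]
    omega
  rw [e, Finset.sum_insert (by simp), add_comm]

variable {P} [Fintype I]

theorem LPFeasible.loadBefore_mem {x : I → Fin T → ℝ} (hx : P.LPFeasible x) (i : I) :
    ∀ n ≤ T, 0 ≤ P.loadBefore x i n ∧ P.loadBefore x i n ≤ 1
  | 0, _ => by simp [loadBefore_zero]
  | n + 1, hn => by
    have ih := hx.loadBefore_mem i n (by omega)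
    have e := P.loadBefore_succ x i ⟨n, hn⟩
    have h := hx.2 i ⟨n, hn⟩
    rw [load_eq_loadBefore] at h
    simp only at e h
    rw [e]
    have hq0 := P.q_nonneg i ⟨n, hn⟩
    have hq1 := P.q_le_one i ⟨n, hn⟩
    have hp0 := P.p_nonneg ⟨n, hn⟩
    have hp1 := P.p_le_one ⟨n, hn⟩
    constructor
    · have := mul_nonneg h.1 hq0; linarith
    · have h1 : x i ⟨n, hn⟩ * P.q i ⟨n, hn⟩ ≤ x i ⟨n, hn⟩ := mul_le_of_le_one_right h.1 hq1
      have h2 : P.p ⟨n, hn⟩ * (1 - P.loadBefore x i n) ≤ 1 - P.loadBefore x i n :=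
        mul_le_of_le_one_left (by linarith) hp1
      linarith

theorem LPFeasible.load_mem {x : I → Fin T → ℝ} (hx : P.LPFeasible x) (i : I) (t : Fin T) :
    0 ≤ P.load x i t ∧ P.load x i t ≤ 1 := by
  rw [load_eq_loadBefore]
  exact hx.loadBefore_mem i t t.2.le

theorem LPFeasible.mul_div_eq {x : I → Fin T → ℝ} (hx : P.LPFeasible x) (i : I) (t : Fin T) :
    P.p t * (x i t / P.p t) = x i t := by
  -- With `p t = 0` the constraint forces `x i t = 0`, so division by zero is harmless.
  by_cases hp : P.p t = 0
  · have := hx.2 i t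
    rw [hp] at this
    have : x i t = 0 := by linarith
    simp [this]
  · field_simp

theorem LPFeasible.div_le {x : I → Fin T → ℝ} (hx : P.LPFeasible x) (i : I) (t : Fin T) :
    x i t / P.p t ≤ 1 - P.load x i t := by
  rcases (P.p_nonneg t).eq_or_lt with hp | hp
  · rw [← hp, div_zero]; linarith [(hx.load_mem i t).2]
  · rw [div_le_iff₀ hp, mul_comm]; exact (hx.2 i t).2

theorem LPFeasible.div_mem {x : I → Fin T → ℝ} (hx : P.LPFeasible x) (t : Fin T) (i : I) :
    0 ≤ x i t / P.p t ∧ x i t / P.p t ≤ 1 :=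
  ⟨div_nonneg (hx.2 i t).1 (P.p_nonneg t), by linarith [hx.div_le i t, (hx.load_mem i t).1]⟩

theorem LPFeasible.sum_div_le {x : I → Fin T → ℝ} (hx : P.LPFeasible x) (t : Fin T) :
    ∑ i, x i t / P.p t ≤ P.c t := by
  rw [← Finset.sum_div]
  rcases (P.p_nonneg t).eq_or_lt with hp | hp
  · rw [← hp, div_zero]; positivity
  · rw [div_le_iff₀ hp, mul_comm]; exact hx.1 t

end Problem

/-! ### Dynamics of the run and first proposals -/

namespace Algorithm

variable {I : Type*} [Fintype I] [DecidableEq I] {T : ℕ}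

/-- The users not successfully allocated to one of the first `n` resources. -/
def availBefore (h : History I T) (n : ℕ) : Finset I :=
  Finset.univ.filter fun i => ∀ t' : Fin T, (t' : ℕ) < n → i ∉ (h t').2

theorem avail_eq_availBefore (h : History I T) (t : Fin T) : avail h t = availBefore h t := by
  ext i; simp [avail, availBefore]

theorem mem_availBefore_update {h : History I T} {t : Fin T} {w : Finset I × Finset I} {i : I} :
    i ∈ availBefore (Function.update h t w) (t + 1) ↔ i ∈ avail h t ∧ i ∉ w.2 := by
  simp only [availBefore, avail, Finset.mem_filter, Finset.mem_univ, true_and]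
  constructor
  · intro H
    refine ⟨fun t' ht' => ?_, by simpa using H t (by omega)⟩
    have := H t' (by have : (t' : ℕ) < t := ht'; omega)
    rwa [Function.update_of_ne ht'.ne] at this
  · rintro ⟨H, hw⟩ t' ht'
    by_cases e : t' = t
    · subst e; simpa using hw
    · rw [Function.update_of_ne e]
      exact H t' (lt_of_le_of_ne (by have : (t' : ℕ) ≤ t := by omega
                                     exact this) e)

variable {P : Problem I T} {PS : PivotalSampler I} {κ : ℝ} {x : I → Fin T → ℝ}

theorem run_succ (t : Fin T) : run P PS κ x (t + 1) =
    (run P PS κ x t).bind fun h => (coin (P.p t)).bind fun arrives =>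
      if arrives then arrivalRound P PS κ x (run P PS κ x t) h t else PMF.pure h := by
  rw [run, dif_pos t.2]

theorem expect_run_succ (t : Fin T) (f : History I T → ℝ) :
    expect (run P PS κ x (t + 1)) f = expect (run P PS κ x t) fun h =>
      (1 - P.p t) * f h + P.p t * expect (arrivalRound P PS κ x (run P PS κ x t) h t) f := by
  rw [run_succ, expect_bind]
  congr 1
  funext h
  rw [expect_coin_bind (P.p_nonneg t) (P.p_le_one t), expect_pure]
  ring

theorem expect_arrivalRound (D : PMF (History I T)) (h : History I T) (t : Fin T)
    (f : History I T → ℝ) :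
    expect (arrivalRound P PS κ x D h t) f = expect (firstAlloc P PS κ x h t) fun A =>
      expect (secondAlloc P PS κ x D h t A) fun B => expect (thin (fun i => P.q i t) (A ∪ B))
        fun S => f (Function.update h t (A ∪ B, S)) := by
  simp only [arrivalRound, expect_bind, expect_pure]

/-- Resources that have not come yet have an empty record. -/
theorem run_support_eq_empty : ∀ (n : ℕ) (h : History I T), h ∈ (run P PS κ x n).support →
    ∀ t : Fin T, n ≤ t → h t = (∅, ∅)
  | 0, h, hh, t, _ => by
    rw [run, PMF.support_pure, Set.mem_singleton_iff] at hh
    rw [hh]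
  | n + 1, h, hh, t, ht => by
    have hn : n < T := by omega
    rw [run_succ (t := ⟨n, hn⟩), PMF.mem_support_bind_iff] at hh
    obtain ⟨g, hg, hh⟩ := hh
    have hgt := run_support_eq_empty n g hg t (by omega)
    rcases mem_support_coin_bind hh with hh | hh
    · simp only [arrivalRound, PMF.mem_support_bind_iff, PMF.support_pure,
        Set.mem_singleton_iff] at hh
      obtain ⟨A, -, B, -, S, -, rfl⟩ := hh
      rw [Function.update_of_ne (by rintro rfl; simp at ht), hgt]
    · rw [PMF.support_pure, Set.mem_singleton_iff] at hh
      rw [hh, hgt]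

/-- Before its round the record of `t` is empty, so it excludes nobody. This is the no-arrival
branch of the recursions for availability. -/
theorem availBefore_succ_of_mem_support {t : Fin T} {h : History I T}
    (hh : h ∈ (run P PS κ x t).support) : availBefore h (t + 1) = avail h t := by
  have e := run_support_eq_empty _ h hh t le_rfl
  rw [avail_eq_availBefore]
  ext i
  simp only [availBefore, Finset.mem_filter, Finset.mem_univ, true_and]
  refine ⟨fun H t' ht' => H t' (by omega), fun H t' ht' => ?_⟩
  rcases Nat.lt_succ_iff_lt_or_eq.1 ht' with h' | h'
  · exact H t' h'
  · rw [Fin.ext h', e]; simp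

/-- The record of a resource does not change after its round. -/
theorem expect_run_of_le (t : Fin T) (f : Finset I × Finset I → ℝ) {n : ℕ} (hn : (t : ℕ) + 1 ≤ n)
    (hT : n ≤ T) : (expect (run P PS κ x n) fun h => f (h t)) =
      expect (run P PS κ x (t + 1)) fun h => f (h t) := by
  induction n, hn using Nat.le_induction with
  | base => rfl
  | succ n hn ih =>
    rw [← ih (by omega)]
    have hne : t ≠ (⟨n, hT⟩ : Fin T) := by rintro rfl; simp at hn
    refine (expect_run_succ ⟨n, hT⟩ _).trans ?_
    congr 1
    funext h
    rw [expect_arrivalRound]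
    simp only [Function.update_of_ne hne, expect_const]
    ring

section FirstProposals

variable (hx : P.LPFeasible x) (hκ : 0 ≤ 0.5 + κ) (hκ' : 0.5 + κ < 1)
include hx hκ hκ'

omit [DecidableEq I] in
theorem one_sub_load_pos (i : I) (t : Fin T) : 0 < 1 - (0.5 + κ) * P.load x i t := by
  have h := hx.load_mem i t
  have : (0.5 + κ) * P.load x i t ≤ 0.5 + κ := mul_le_of_le_one_right hκ h.2
  linarith

omit [DecidableEq I] in
theorem alpha_nonneg (i : I) (t : Fin T) : 0 ≤ alpha P κ x i t :=
  le_min zero_le_one (div_nonneg hκ (one_sub_load_pos hx hκ hκ' i t).le)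

omit [Fintype I] [DecidableEq I] hx hκ hκ' in
theorem alpha_le_one (i : I) (t : Fin T) : alpha P κ x i t ≤ 1 := min_le_left _ _

theorem expect_firstAlloc_mem (h : History I T) (t : Fin T) (i : I) :
    (expect (firstAlloc P PS κ x h t) fun A => if i ∈ A then 1 else 0) =
      if i ∈ avail h t then alpha P κ x i t * (x i t / P.p t) else 0 := by
  rw [firstAlloc, expect_bind]
  simp only [expect_thin_mem _ (fun k _ => alpha_nonneg hx hκ hκ' k t) (fun k _ => alpha_le_one k t)]
  split_ifs with hi
  · rw [← (PS.isPivotal _ (hx.div_mem t)).expect_mem (hx.div_mem t) i, ← expect_mul_left]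
    simp [hi]
  · simp [hi, expect_const]

theorem expect_firstAlloc_mem_mem_le (h : History I T) (t : Fin T) {i j : I} (hij : i ≠ j) :
    (expect (firstAlloc P PS κ x h t) fun A => (if i ∈ A then 1 else 0) * if j ∈ A then 1 else 0) ≤
      alpha P κ x i t * (x i t / P.p t) * (alpha P κ x j t * (x j t / P.p t)) := by
  have hi := alpha_nonneg hx hκ hκ' i t
  have hj := alpha_nonneg hx hκ hκ' j t
  rw [firstAlloc, expect_bind]
  simp only [expect_thin_mem_mem _ (fun k _ => alpha_nonneg hx hκ hκ' k t) (fun k _ => alpha_le_one k t) hij]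
  calc _ ≤ expect (PS.sample fun i => x i t / P.p t) fun F => alpha P κ x i t * alpha P κ x j t *
        ((if i ∈ F then 1 else 0) * if j ∈ F then 1 else 0) := by
        refine expect_mono fun F _ => ?_
        simp only [Finset.mem_inter]
        have := mul_nonneg hi hj
        by_cases h1 : i ∈ F <;> by_cases h2 : j ∈ F <;> by_cases h3 : i ∈ avail h t <;>
          by_cases h4 : j ∈ avail h t <;> simp [h1, h2, h3, h4, this]
    _ ≤ alpha P κ x i t * alpha P κ x j t * (x i t / P.p t * (x j t / P.p t)) := by
        rw [expect_mul_left]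
        exact mul_le_mul_of_nonneg_left ((PS.isPivotal _ (hx.div_mem t)).expect_mem_mul_mem_le
          (hx.div_mem t) hij) (mul_nonneg hi hj)
    _ = _ := by ring

omit hκ hκ' in
theorem firstAlloc_support {h : History I T} {t : Fin T} {A : Finset I}
    (hA : A ∈ (firstAlloc P PS κ x h t).support) : A ⊆ avail h t ∧ A.card ≤ P.c t := by
  rw [firstAlloc, PMF.mem_support_bind_iff] at hA
  obtain ⟨F, hF, hA⟩ := hA
  have hs := subset_of_mem_support_thin hA
  refine ⟨hs.trans Finset.inter_subset_right, (Finset.card_le_card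
    (hs.trans Finset.inter_subset_left)).trans ?_⟩
  exact (PS.isPivotal _ (hx.div_mem t)).card_le (hx.div_mem t) (hx.sum_div_le t) hF

end FirstProposals

theorem secondAlloc_support {D : PMF (History I T)} {h : History I T} {t : Fin T}
    {A B : Finset I} (hB : B ∈ (secondAlloc P PS κ x D h t A).support) :
    B ⊆ avail h t ∧ Disjoint A B := by
  rw [secondAlloc, PMF.mem_support_bind_iff] at hB
  obtain ⟨F, hF, hB⟩ := hB
  have hs := (subset_of_mem_support_thin hB).trans (Finset.filter_subset _ _)
  exact ⟨(hs.trans Finset.sdiff_subset).trans Finset.inter_subset_right,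
    (Finset.sdiff_disjoint.mono_left hs).symm⟩

omit [Fintype I] [DecidableEq I] in
theorem one_sub_card_div_mem {c : ℕ} {A : Finset I} (hA : A.card ≤ c) :
    0 ≤ 1 - (A.card : ℝ) / c ∧ 1 - (A.card : ℝ) / c ≤ 1 := by
  have h : (A.card : ℝ) / c ≤ 1 := div_le_one_of_le₀ (by exact_mod_cast hA) (by positivity)
  have : 0 ≤ (A.card : ℝ) / c := by positivity
  constructor <;> linarith

theorem rho_nonneg (hx : P.LPFeasible x) (D : PMF (History I T)) (i : I) (t : Fin T) :
    0 ≤ rho P PS κ x D i t := by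
  refine expect_nonneg fun h => ?_
  refine (expect_const (firstAlloc P PS κ x h t) (0 : ℝ)).symm.le.trans
    (expect_mono fun A hA => ?_)
  split_ifs
  · exact (one_sub_card_div_mem (firstAlloc_support hx hA).2).1
  · exact le_refl (0 : ℝ)

end Algorithm

/-! ### Numerical inequalities for `κ = 0.0115` -/

section Numerics

/-- Cauchy–Schwarz for the two-valued variables equal to `1` without an arrival and to `s`, `t` with
one; the gap is `p * (1 - p) * (s - t) ^ 2`. -/
theorem lazy_square_le {p s t : ℝ} (h0 : 0 ≤ p) (h1 : p ≤ 1) :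
    (1 - p + p * (s * t)) ^ 2 ≤ (1 - p + p * s ^ 2) * (1 - p + p * t ^ 2) := by
  have : 0 ≤ p * (1 - p) * (s - t) ^ 2 :=
    mul_nonneg (mul_nonneg h0 (by linarith)) (sq_nonneg _)
  nlinarith

/-- The value of `alpha` for load `y`: it is `1` for high loads, and the quotient otherwise. -/
theorem min_one_div_cases {y : ℝ} (h1 : y ≤ 1) :
    (0.4885 ≤ 0.5115 * y ∧ min 1 (0.5115 / (1 - 0.5115 * y)) = 1) ∨
      (0.5115 * y < 0.4885 ∧
        min 1 (0.5115 / (1 - 0.5115 * y)) = 0.5115 / (1 - 0.5115 * y)) := by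
  have hw : (0 : ℝ) < 1 - 0.5115 * y := by linarith
  rcases le_or_gt 0.4885 (0.5115 * y) with h | h
  · exact Or.inl ⟨h, min_eq_left (by rw [le_div_iff₀ hw]; linarith)⟩
  · exact Or.inr ⟨h, min_eq_right (by rw [div_le_one hw]; linarith)⟩

/-- This makes `1 - 0.65 * y` a valid potential for the decay. For a general slope `s` in place of
`0.65`, the case `y = 1` reads `2 * (1 - s) ≥ s`, so `s` cannot exceed `2 / 3`. -/
theorem slope_le {y : ℝ} (h0 : 0 ≤ y) (h1 : y ≤ 1) :
    0.65 ≤ (1 - 0.65 * y) * (2 * min 1 (0.5115 / (1 - 0.5115 * y)) -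
      min 1 (0.5115 / (1 - 0.5115 * y)) ^ 2 * (1 - y)) := by
  have hw : (0 : ℝ) < 1 - 0.5115 * y := by linarith
  rcases min_one_div_cases h1 with ⟨h, e⟩ | ⟨h, e⟩ <;> rw [e]
  · nlinarith
  · have e2 : (1 - 0.65 * y) * (2 * (0.5115 / (1 - 0.5115 * y)) -
        (0.5115 / (1 - 0.5115 * y)) ^ 2 * (1 - y)) =
        ((1 - 0.65 * y) * (0.5115 * (2 * (1 - 0.5115 * y) - 0.5115 * (1 - y)))) /
          (1 - 0.5115 * y) ^ 2 := by
      field_simp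
    rw [e2, le_div_iff₀ (by positivity)]
    nlinarith

/-- The left side is largest where `alpha` reaches `1`, at `y = 0.4885 / 0.5115`, with value about
`0.379`. -/
theorem sq_mul_le {y : ℝ} (h1 : y ≤ 1) :
    min 1 (0.5115 / (1 - 0.5115 * y)) ^ 2 * (1 - 0.65 * y) ≤ 0.4 := by
  have hw : (0 : ℝ) < 1 - 0.5115 * y := by linarith
  rcases min_one_div_cases h1 with ⟨h, e⟩ | ⟨h, e⟩ <;> rw [e]
  · nlinarith
  · rw [div_pow, div_mul_eq_mul_div, div_le_iff₀ (by positivity)]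
    nlinarith

/-- One round of the decay of the squared bound on the joint availability. -/
theorem lazy_decay_le {p x q y α : ℝ} (hp0 : 0 ≤ p) (hx0 : 0 ≤ x) (hx : x / p ≤ 1 - y)
    (hpx : p * (x / p) = x) (hq0 : 0 ≤ q) (hq1 : q ≤ 1) (h0 : 0 ≤ y) (h1 : y ≤ 1)
    (hα : α = min 1 (0.5115 / (1 - 0.5115 * y))) :
    (1 - 0.65 * y) * (1 - p + p * (1 - q * (α * (x / p))) ^ 2) ≤ 1 - 0.65 * (y + x * q) := by
  have hs := slope_le h0 h1
  rw [← hα] at hs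
  have hz0 : 0 ≤ x / p := div_nonneg hx0 hp0
  set z := x / p with hz
  have hxq : 0 ≤ x * q := mul_nonneg hx0 hq0
  have e : 1 - p + p * (1 - q * (α * z)) ^ 2 = 1 - x * q * (2 * α) + x * q * (α ^ 2 * (q * z)) := by
    rw [← hpx]; ring
  -- The online constraint `x ≤ p * (1 - y)` enters here: it limits the second-order term of the
  -- square.
  have hqz : q * z ≤ 1 - y := (mul_le_of_le_one_left hz0 hq1).trans hx
  have h2 : x * q * (α ^ 2 * (q * z)) ≤ x * q * (α ^ 2 * (1 - y)) := by gcongr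
  have h3 : 0 ≤ 1 - 0.65 * y := by linarith
  rw [e]
  calc _ ≤ (1 - 0.65 * y) * (1 - x * q * (2 * α) + x * q * (α ^ 2 * (1 - y))) := by gcongr
    _ = (1 - 0.65 * y) - x * q * ((1 - 0.65 * y) * (2 * α - α ^ 2 * (1 - y))) := by ring
    _ ≤ (1 - 0.65 * y) - x * q * 0.65 := by gcongr
    _ = _ := by ring

end Numerics

/-! ### Second proposals and joint availability -/

namespace Algorithm

variable {I : Type*} [Fintype I] [DecidableEq I] {T : ℕ}
variable {P : Problem I T} {PS : PivotalSampler I} {κ : ℝ} {x : I → Fin T → ℝ}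

theorem beta_mem {D : PMF (History I T)} {i : I} {t : Fin T} (hx : P.LPFeasible x)
    (hκ : 0 ≤ 0.5 + κ) (hκ' : 0.5 + κ < 1) (hα : alpha P κ x i t = 1) :
    0 ≤ (0.5 + κ) * P.load x i t - (0.5 - κ) ∧
      0 ≤ beta P PS κ x D i t ∧ beta P PS κ x D i t ≤ 1 := by
  have hw := one_sub_load_pos hx hκ hκ' i t
  rw [alpha, min_eq_left_iff, le_div_iff₀ hw] at hα
  have h : 0 ≤ (0.5 + κ) * P.load x i t - (0.5 - κ) := by linarith
  exact ⟨h, le_min zero_le_one (mul_nonneg h (one_div_nonneg.2 (rho_nonneg hx D i t))),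
    min_le_left _ _⟩

/-- When the deficit is at most `rho` the truncation at `1` is inactive. A zero deficit is separate,
since `rho` may then vanish. -/
theorem beta_mul_rho {D : PMF (History I T)} {i : I} {t : Fin T}
    (h0 : 0 ≤ (0.5 + κ) * P.load x i t - (0.5 - κ))
    (h : (0.5 + κ) * P.load x i t - (0.5 - κ) ≤ rho P PS κ x D i t) :
    beta P PS κ x D i t * rho P PS κ x D i t = (0.5 + κ) * P.load x i t - (0.5 - κ) := by
  rw [beta]
  rcases h0.eq_or_lt with h1 | h1
  · rw [← h1]; simp
  · have hρ := h1.trans_le h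
    rw [min_eq_right (by rw [mul_one_div, div_le_one hρ]; exact h), mul_assoc, one_div,
      inv_mul_cancel₀ hρ.ne', mul_one]

/-- Only the marginals of the second sample matter. They carry the factor `1 - |A| / c`, whose
average over the past and `A` is exactly `rho`. -/
theorem expect_secondAlloc_mem (hx : P.LPFeasible x) (hκ : 0 ≤ 0.5 + κ) (hκ' : 0.5 + κ < 1)
    (D : PMF (History I T)) (h : History I T) (t : Fin T) {A : Finset I}
    (hA : A.card ≤ P.c t) (i : I) :
    (expect (secondAlloc P PS κ x D h t A) fun B => if i ∈ B then 1 else 0) =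
      (if alpha P κ x i t = 1 then beta P PS κ x D i t * (x i t / P.p t) else 0) *
        if i ∈ avail h t ∧ i ∉ A then 1 - (A.card : ℝ) / P.c t else 0 := by
  have hc := one_sub_card_div_mem hA
  have hz : ∀ k, 0 ≤ (1 - (A.card : ℝ) / P.c t) * x k t / P.p t ∧
      (1 - (A.card : ℝ) / P.c t) * x k t / P.p t ≤ 1 := by
    intro k
    have := hx.div_mem t k
    rw [mul_div_assoc]
    exact ⟨mul_nonneg hc.1 this.1, mul_le_one₀ hc.2 this.1 this.2⟩
  rw [secondAlloc, expect_bind]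
  refine (expect_congr (g := fun F => if i ∈ F then (if alpha P κ x i t = 1 then
    beta P PS κ x D i t else 0) * (if i ∈ avail h t ∧ i ∉ A then 1 else 0) else 0) fun F _ =>
    (expect_thin_mem _ (fun k hk => ?_) (fun k hk => ?_) i).trans ?_).trans ?_
  · exact (beta_mem hx hκ hκ' (Finset.mem_filter.1 hk).2).2.1
  · exact (beta_mem hx hκ hκ' (Finset.mem_filter.1 hk).2).2.2
  · simp only [Finset.mem_filter, Finset.mem_sdiff, Finset.mem_inter]
    by_cases h1 : i ∈ F <;> by_cases h2 : i ∈ avail h t <;> by_cases h3 : i ∈ A <;>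
      simp [h1, h2, h3]
  · have := (PS.isPivotal _ hz).expect_mem hz i
    have e : ∀ r : ℝ, (expect (PS.sample fun k => (1 - (A.card : ℝ) / P.c t) * x k t / P.p t)
        fun F => if i ∈ F then r else 0) = r * ((1 - (A.card : ℝ) / P.c t) * x i t / P.p t) := by
      intro r
      rw [← this, ← expect_mul_left]
      simp
    rw [e]
    split_ifs <;> ring

/-- The probability of an allocation to `t` when it arrives. -/
theorem expect_alloc_mem (hx : P.LPFeasible x) (hκ : 0 ≤ 0.5 + κ) (hκ' : 0.5 + κ < 1)
    (D : PMF (History I T)) (h : History I T) (t : Fin T) (i : I) :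
    (expect (firstAlloc P PS κ x h t) fun A => expect (secondAlloc P PS κ x D h t A) fun B =>
      if i ∈ A ∪ B then 1 else 0) =
    (if i ∈ avail h t then alpha P κ x i t * (x i t / P.p t) else 0) +
      (if alpha P κ x i t = 1 then beta P PS κ x D i t * (x i t / P.p t) else 0) *
        expect (firstAlloc P PS κ x h t) fun A =>
          if i ∈ avail h t ∧ i ∉ A then 1 - (A.card : ℝ) / P.c t else 0 := by
  rw [← expect_firstAlloc_mem hx hκ hκ' h t i, ← expect_mul_left, ← expect_add]
  refine expect_congr fun A hA => ?_
  rw [← expect_secondAlloc_mem hx hκ hκ' D h t (firstAlloc_support hx hA).2,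
    ← expect_const (secondAlloc P PS κ x D h t A) (if i ∈ A then (1 : ℝ) else 0), ← expect_add]
  refine expect_congr fun B hB => ?_
  by_cases h1 : i ∈ A
  · simp [h1, Finset.disjoint_left.1 (secondAlloc_support hB).2 h1]
  · simp [h1]

theorem expect_run_alloc (hx : P.LPFeasible x) (hκ : 0 ≤ 0.5 + κ) (hκ' : 0.5 + κ < 1)
    (t : Fin T) (i : I) :
    (expect (run P PS κ x t) fun h => expect (firstAlloc P PS κ x h t) fun A =>
      expect (secondAlloc P PS κ x (run P PS κ x t) h t A) fun B => if i ∈ A ∪ B then 1 else 0) =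
    x i t / P.p t * (alpha P κ x i t *
      (expect (run P PS κ x t) fun h => if i ∈ avail h t then 1 else 0) +
      if alpha P κ x i t = 1 then
        beta P PS κ x (run P PS κ x t) i t * rho P PS κ x (run P PS κ x t) i t else 0) := by
  simp only [expect_alloc_mem hx hκ hκ']
  rw [expect_add, expect_mul_left, ← rho]
  have e : (fun h : History I T => if i ∈ avail h t then alpha P κ x i t * (x i t / P.p t) else 0) =
      fun h => (alpha P κ x i t * (x i t / P.p t)) * if i ∈ avail h t then 1 else 0 := by
    funext h; simp
  rw [e, expect_mul_left]
  split_ifs <;> ring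

section Joint

variable (hx : P.LPFeasible x) (hκ : 0 ≤ 0.5 + κ) (hκ' : 0.5 + κ < 1)
include hx hκ hκ'

theorem expect_arrivalRound_joint_le (D : PMF (History I T)) (h : History I T) (t : Fin T)
    {i j : I} (hij : i ≠ j) :
    (expect (arrivalRound P PS κ x D h t) fun g =>
      if i ∈ availBefore g (t + 1) ∧ j ∈ availBefore g (t + 1) then 1 else 0) ≤
    (if i ∈ avail h t ∧ j ∈ avail h t then 1 else 0) *
      ((1 - P.q i t * (alpha P κ x i t * (x i t / P.p t))) *
        (1 - P.q j t * (alpha P κ x j t * (x j t / P.p t)))) := by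
  rw [expect_arrivalRound]
  simp only [mem_availBefore_update]
  by_cases hav : i ∈ avail h t ∧ j ∈ avail h t
  swap
  · have : ∀ S : Finset I, ¬ ((i ∈ avail h t ∧ i ∉ S) ∧ (j ∈ avail h t ∧ j ∉ S)) := by tauto
    simp [this, hav, expect_const]
  have hq0 := fun k => P.q_nonneg k t
  have hq1 := fun k => P.q_le_one k t
  have e : ∀ S : Finset I, (if (i ∈ avail h t ∧ i ∉ S) ∧ (j ∈ avail h t ∧ j ∉ S) then (1 : ℝ)
      else 0) = (if i ∈ S then 0 else 1) * if j ∈ S then 0 else 1 := by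
    intro S; by_cases h1 : i ∈ S <;> by_cases h2 : j ∈ S <;> simp [h1, h2, hav]
  simp only [e, expect_thin_notMem_notMem _ (fun k _ => hq0 k) (fun k _ => hq1 k) hij]
  rw [if_pos hav, one_mul]
  -- Dropping the second proposals `B` only raises the survival probability. Expanding the product
  -- leaves the pair term with a nonnegative coefficient, so negative correlation bounds it in the
  -- right direction.
  calc _ ≤ expect (firstAlloc P PS κ x h t) fun A =>
        (1 - P.q i t * if i ∈ A then 1 else 0) - (P.q j t * if j ∈ A then 1 else 0) +
          P.q i t * P.q j t * ((if i ∈ A then 1 else 0) * if j ∈ A then 1 else 0) := by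
        refine expect_mono fun A _ => ?_
        refine (expect_mono (g := fun _ => (1 - P.q i t * if i ∈ A then 1 else 0) -
          (P.q j t * if j ∈ A then 1 else 0) +
          P.q i t * P.q j t * ((if i ∈ A then 1 else 0) * if j ∈ A then 1 else 0))
          fun B _ => ?_).trans (expect_const _ _).le
        have hi0 := hq0 i
        have hi1 := hq1 i
        have hj0 := hq0 j
        have hj1 := hq1 j
        by_cases h1 : i ∈ A <;> by_cases h2 : j ∈ A <;> by_cases h3 : i ∈ B <;>
          by_cases h4 : j ∈ B <;> simp [h1, h2, h3, h4] <;> nlinarith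
    _ ≤ _ := by
        rw [expect_add, expect_sub, expect_sub, expect_const, expect_mul_left, expect_mul_left,
          expect_mul_left, expect_firstAlloc_mem hx hκ hκ', expect_firstAlloc_mem hx hκ hκ',
          if_pos hav.1, if_pos hav.2]
        have := mul_le_mul_of_nonneg_left (expect_firstAlloc_mem_mem_le (PS := PS) hx hκ hκ' h t hij)
          (mul_nonneg (hq0 i) (hq0 j))
        linarith

/-- The probability that two users are both available decays at least as if they were proposed to
independently. -/
theorem expect_run_succ_joint_le (t : Fin T) {i j : I} (hij : i ≠ j) :
    (expect (run P PS κ x (t + 1)) fun h =>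
      if i ∈ availBefore h (t + 1) ∧ j ∈ availBefore h (t + 1) then 1 else 0) ≤
    (expect (run P PS κ x t) fun h => if i ∈ availBefore h t ∧ j ∈ availBefore h t then 1 else 0) *
      (1 - P.p t + P.p t * ((1 - P.q i t * (alpha P κ x i t * (x i t / P.p t))) *
        (1 - P.q j t * (alpha P κ x j t * (x j t / P.p t))))) := by
  rw [expect_run_succ, ← expect_mul_right]
  refine expect_mono fun h hh => ?_
  have := mul_le_mul_of_nonneg_left (expect_arrivalRound_joint_le (PS := PS) hx hκ hκ'
    (run P PS κ x t) h t hij) (P.p_nonneg t)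
  rw [availBefore_succ_of_mem_support hh]
  rw [avail_eq_availBefore] at this ⊢
  linarith

end Joint

omit [Fintype I] [DecidableEq I] in
theorem alpha_eq (i : I) (t : Fin T) : alpha P 0.0115 x i t =
    min 1 (0.5115 / (1 - 0.5115 * P.loadBefore x i t)) := by
  rw [alpha, Problem.load_eq_loadBefore]
  norm_num

/-- Squaring lets Cauchy–Schwarz separate the two users, who otherwise share the arrival coin;
`lazy_decay_le` then advances each factor. Nothing about `beta` or individual availability is
needed. -/
theorem joint_sq_le (hx : P.LPFeasible x) {i j : I} (hij : i ≠ j) :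
    ∀ n ≤ T, (expect (run P PS 0.0115 x n) fun h =>
      if i ∈ availBefore h n ∧ j ∈ availBefore h n then 1 else 0) ^ 2 ≤
        (1 - 0.65 * P.loadBefore x i n) * (1 - 0.65 * P.loadBefore x j n)
  | 0, _ => by
    simp [run, expect_pure, availBefore, Problem.loadBefore_zero]
  | n + 1, hn => by
    obtain ⟨t, rfl⟩ : ∃ t : Fin T, n = t := ⟨⟨n, hn⟩, rfl⟩
    have ih := joint_sq_le hx hij t (by omega)
    have hstep := expect_run_succ_joint_le (PS := PS) (κ := 0.0115) hx (by norm_num) (by norm_num)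
      t hij
    have hnn : 0 ≤ expect (run P PS 0.0115 x (t + 1)) fun h =>
        if i ∈ availBefore h (t + 1) ∧ j ∈ availBefore h (t + 1) then 1 else 0 :=
      expect_nonneg fun h => by split_ifs <;> norm_num
    refine (pow_le_pow_left₀ hnn hstep 2).trans ?_
    rw [mul_pow, P.loadBefore_succ, P.loadBefore_succ]
    have hp0 := P.p_nonneg t
    have hp1 := P.p_le_one t
    have hCS := lazy_square_le (s := 1 - P.q i t * (alpha P 0.0115 x i t * (x i t / P.p t)))
      (t := 1 - P.q j t * (alpha P 0.0115 x j t * (x j t / P.p t))) hp0 hp1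
    have hd : ∀ k, (1 - 0.65 * P.loadBefore x k t) * (1 - P.p t + P.p t *
        (1 - P.q k t * (alpha P 0.0115 x k t * (x k t / P.p t))) ^ 2) ≤
        1 - 0.65 * (P.loadBefore x k t + x k t * P.q k t) := fun k => by
      have hl := hx.loadBefore_mem k t t.2.le
      have hdv := hx.div_le k t
      rw [Problem.load_eq_loadBefore] at hdv
      exact lazy_decay_le hp0 (hx.2 k t).1 hdv (hx.mul_div_eq k t)
        (P.q_nonneg k t) (P.q_le_one k t) hl.1 hl.2 (alpha_eq k t)
    have hw : ∀ k, 0 ≤ 1 - 0.65 * P.loadBefore x k t := fun k => by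
      linarith [(hx.loadBefore_mem k t t.2.le).2]
    have hs : ∀ s : ℝ, 0 ≤ 1 - P.p t + P.p t * s ^ 2 := fun s => by
      have := mul_nonneg hp0 (sq_nonneg s); linarith
    calc _ ≤ ((1 - 0.65 * P.loadBefore x i t) * (1 - 0.65 * P.loadBefore x j t)) * _ :=
          mul_le_mul ih hCS (sq_nonneg _) (mul_nonneg (hw i) (hw j))
      _ = ((1 - 0.65 * P.loadBefore x i t) * (1 - P.p t + P.p t *
            (1 - P.q i t * (alpha P 0.0115 x i t * (x i t / P.p t))) ^ 2)) *
          ((1 - 0.65 * P.loadBefore x j t) * (1 - P.p t + P.p t *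
            (1 - P.q j t * (alpha P 0.0115 x j t * (x j t / P.p t))) ^ 2)) := by ring
      _ ≤ _ := mul_le_mul (hd i) (hd j) (mul_nonneg (hw j) (hs _))
          ((mul_nonneg (hw i) (hs _)).trans (hd i))

/-- The joint availability is small compared with the availability of a heavily loaded user. -/
theorem alpha_mul_joint_le (hx : P.LPFeasible x) {i j : I} (hij : i ≠ j) (t : Fin T)
    (hα : alpha P 0.0115 x i t = 1) :
    alpha P 0.0115 x j t * (expect (run P PS 0.0115 x t) fun h =>
      if i ∈ avail h t ∧ j ∈ avail h t then 1 else 0) ≤ 0.4 := by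
  have hi := hx.loadBefore_mem i t t.2.le
  have hj := hx.loadBefore_mem j t t.2.le
  have h1 := sq_mul_le hi.2
  have h2 := sq_mul_le hj.2
  rw [← alpha_eq, hα, one_pow, one_mul] at h1
  rw [← alpha_eq] at h2
  have h := joint_sq_le (PS := PS) hx hij t t.2.le
  simp only [avail_eq_availBefore]
  refine le_of_sq_le_sq ?_ (by norm_num)
  rw [mul_pow]
  calc _ ≤ alpha P 0.0115 x j t ^ 2 *
        ((1 - 0.65 * P.loadBefore x i t) * (1 - 0.65 * P.loadBefore x j t)) := by gcongr
    _ = (1 - 0.65 * P.loadBefore x i t) *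
        (alpha P 0.0115 x j t ^ 2 * (1 - 0.65 * P.loadBefore x j t)) := by ring
    _ ≤ 0.4 * 0.4 := mul_le_mul h1 h2
        (mul_nonneg (sq_nonneg _) (by linarith)) (by norm_num)
    _ = _ := by norm_num

end Algorithm

/-! ### Lower bound on `rho` and exact allocation probabilities -/

namespace Algorithm

variable {I : Type*} [Fintype I] [DecidableEq I] {T : ℕ}
variable {P : Problem I T} {PS : PivotalSampler I} {κ : ℝ} {x : I → Fin T → ℝ}

/-- If first proposals to others rarely coincide with the availability of `i`, then enough capacity
is left for a second proposal to `i`. -/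
theorem le_rho (hx : P.LPFeasible x) (hκ : 0 ≤ 0.5 + κ) (hκ' : 0.5 + κ < 1)
    (D : PMF (History I T)) {t : Fin T} {i : I} (hc : P.c t ≠ 0) {M : ℝ} (hM : 0 ≤ M)
    (h : ∀ j, i ≠ j → alpha P κ x j t *
      (expect D fun h => if i ∈ avail h t ∧ j ∈ avail h t then 1 else 0) ≤ M) :
    (1 - x i t / P.p t) * ((expect D fun h => if i ∈ avail h t then 1 else 0) - M) ≤
      rho P PS κ x D i t := by
  have hc0 : (0 : ℝ) < P.c t := by exact_mod_cast Nat.pos_of_ne_zero hc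
  have hPS := PS.isPivotal _ (hx.div_mem t)
  simp only [rho, firstAlloc, expect_bind]
  have hF : (expect (PS.sample fun i => x i t / P.p t) fun F => 1 - if i ∈ F then 1 else 0) =
      1 - x i t / P.p t := by
    rw [expect_sub, expect_const, hPS.expect_mem (hx.div_mem t)]
  -- The first sample is independent of the history, so it can be fixed before averaging over the
  -- history.
  rw [expect_comm, ← hF, ← expect_mul_right]
  refine expect_mono fun F hF => ?_
  have hcard : (F.card : ℝ) ≤ P.c t := by
    exact_mod_cast hPS.card_le (hx.div_mem t) (hx.sum_div_le t) hF
  by_cases hiF : i ∈ F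
  -- Samples containing `i` are simply discarded; this costs the factor `1 - x i t / p t`.
  · rw [if_pos hiF, sub_self, zero_mul]
    refine expect_nonneg fun h => ?_
    refine (expect_const (thin _ _) (0 : ℝ)).symm.le.trans (expect_mono fun A hA => ?_)
    split_ifs
    · have hAF := Finset.card_le_card
        ((subset_of_mem_support_thin hA).trans Finset.inter_subset_left)
      exact (one_sub_card_div_mem (hAF.trans (by exact_mod_cast hcard))).1
    · exact le_refl (0 : ℝ)
  · have e : ∀ h : History I T, (expect (thin (fun i => alpha P κ x i t) (F ∩ avail h t)) fun A =>
        if i ∈ avail h t ∧ i ∉ A then 1 - (A.card : ℝ) / P.c t else 0) =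
        (if i ∈ avail h t then 1 else 0) - ∑ j ∈ F, alpha P κ x j t / P.c t *
          if i ∈ avail h t ∧ j ∈ avail h t then 1 else 0 := by
      intro h
      by_cases hav : i ∈ avail h t
      · have e1 : ∀ A ∈ (thin (fun i => alpha P κ x i t) (F ∩ avail h t)).support,
            (if i ∈ avail h t ∧ i ∉ A then 1 - (A.card : ℝ) / P.c t else 0) =
              1 - ∑ j ∈ F, 1 / (P.c t : ℝ) * if j ∈ A then 1 else 0 := by
          intro A hA
          have hAF := (subset_of_mem_support_thin hA).trans Finset.inter_subset_left
          rw [if_pos ⟨hav, fun hi => hiF (hAF hi)⟩, ← Finset.mul_sum, Finset.sum_boole,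
            Finset.filter_mem_eq_inter, Finset.inter_eq_right.2 hAF]
          ring
        rw [expect_congr e1, expect_sub, expect_const, expect_sum, if_pos hav]
        congr 1
        refine Finset.sum_congr rfl fun j hj => ?_
        rw [expect_mul_left, expect_thin_mem _ (fun k _ => alpha_nonneg hx hκ hκ' k t)
          (fun k _ => alpha_le_one k t)]
        simp only [Finset.mem_inter, hj, hav, true_and]
        split_ifs <;> ring
      · simp [hav, expect_const]
    simp only [e]
    rw [if_neg hiF, sub_zero, one_mul, expect_sub, expect_sum]
    have hsum : ∑ j ∈ F, (expect D fun h => alpha P κ x j t / P.c t *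
        if i ∈ avail h t ∧ j ∈ avail h t then 1 else 0) ≤ ∑ j ∈ F, M / P.c t := by
      refine Finset.sum_le_sum fun j hj => ?_
      rw [expect_mul_left, div_mul_eq_mul_div]
      exact div_le_div_of_nonneg_right (h j (by rintro rfl; exact hiF hj)) hc0.le
    rw [Finset.sum_const, nsmul_eq_mul] at hsum
    have : F.card * (M / P.c t) ≤ M := by
      rw [mul_div_assoc', div_le_iff₀ hc0, mul_comm]
      exact mul_le_mul_of_nonneg_left hcard hM
    linarith

/-- The law of the records of `t`, in terms of the allocation when `t` arrives. -/
theorem expect_run_succ_record (t : Fin T) (f : Finset I × Finset I → ℝ) (hf : f (∅, ∅) = 0) :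
    (expect (run P PS κ x (t + 1)) fun h => f (h t)) =
      P.p t * expect (run P PS κ x t) fun h => expect (firstAlloc P PS κ x h t) fun A =>
        expect (secondAlloc P PS κ x (run P PS κ x t) h t A) fun B =>
          expect (thin (fun i => P.q i t) (A ∪ B)) fun S => f (A ∪ B, S) := by
  rw [expect_run_succ, ← expect_mul_left]
  refine expect_congr fun h hh => ?_
  rw [run_support_eq_empty _ h hh t le_rfl, hf, expect_arrivalRound]
  simp

theorem expect_arrivalRound_avail (hx : P.LPFeasible x) (D : PMF (History I T))
    (h : History I T) (t : Fin T) (i : I) :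
    (expect (arrivalRound P PS κ x D h t) fun g => if i ∈ availBefore g (t + 1) then 1 else 0) =
      (if i ∈ avail h t then 1 else 0) - P.q i t * expect (firstAlloc P PS κ x h t) fun A =>
        expect (secondAlloc P PS κ x D h t A) fun B => if i ∈ A ∪ B then 1 else 0 := by
  rw [expect_arrivalRound, ← expect_const (firstAlloc P PS κ x h t) (if i ∈ avail h t then (1 : ℝ)
    else 0), ← expect_mul_left, ← expect_sub]
  refine expect_congr fun A hA => ?_
  rw [← expect_const (secondAlloc P PS κ x D h t A) (if i ∈ avail h t then (1 : ℝ)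
    else 0), ← expect_mul_left, ← expect_sub]
  refine expect_congr fun B hB => ?_
  simp only [mem_availBefore_update]
  have hAB : A ∪ B ⊆ avail h t :=
    Finset.union_subset (firstAlloc_support hx hA).1 (secondAlloc_support hB).1
  by_cases hav : i ∈ avail h t
  · have := expect_thin_notMem (A ∪ B) (fun k _ => P.q_nonneg k t) (fun k _ => P.q_le_one k t) i
    simp only [hav, true_and, ite_not, if_true]
    rw [this]
    split_ifs <;> ring
  · have : i ∉ A ∪ B := fun hi => hav (hAB hi)
    rw [if_neg this]
    simp [hav, expect_const]

/-- If `i` is available at `t` with the right probability, it is allocated to `t` with the right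
probability. -/
theorem expect_alloc_of_avail (hx : P.LPFeasible x) (t : Fin T) (i : I)
    (hav : (expect (run P PS 0.0115 x t) fun h => if i ∈ avail h t then 1 else 0) =
      1 - (0.5 + 0.0115) * P.load x i t) :
    P.p t * (expect (run P PS 0.0115 x t) fun h => expect (firstAlloc P PS 0.0115 x h t) fun A =>
      expect (secondAlloc P PS 0.0115 x (run P PS 0.0115 x t) h t A) fun B =>
        if i ∈ A ∪ B then 1 else 0) = (0.5 + 0.0115) * x i t := by
  have hκ : (0 : ℝ) ≤ 0.5 + 0.0115 := by norm_num
  have hκ' : (0.5 : ℝ) + 0.0115 < 1 := by norm_num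
  rw [expect_run_alloc hx hκ hκ', ← mul_assoc, hx.mul_div_eq, hav]
  -- A positive `x i t` is needed below to exclude zero capacity.
  rcases (hx.2 i t).1.eq_or_lt with h0 | h0
  · rw [← h0]; ring
  rw [mul_comm (_ + _) (x i t)]
  congr 1
  have hw := one_sub_load_pos hx hκ hκ' i t
  have hl := hx.load_mem i t
  split_ifs with hα
  · have hc : P.c t ≠ 0 := by
      intro hc
      have h1 := hx.1 t
      have h2 := Finset.single_le_sum (fun j _ => (hx.2 j t).1) (Finset.mem_univ i)
      rw [hc, Nat.cast_zero, mul_zero] at h1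
      linarith
    have hβ := (beta_mem (PS := PS) (D := run P PS 0.0115 x t) hx hκ hκ' hα).1
    have hρ := le_rho (PS := PS) hx hκ hκ' (run P PS 0.0115 x t) hc (M := 0.4) (by norm_num)
      fun j hij => alpha_mul_joint_le hx hij t hα
    rw [hav] at hρ
    have hz := hx.div_le i t
    -- Here `1 - x / p ≥ y`, again by the online constraint.
    have hρ' : P.load x i t * (1 - (0.5 + 0.0115) * P.load x i t - 0.4) ≤
        rho P PS 0.0115 x (run P PS 0.0115 x t) i t := by
      refine le_trans (mul_le_mul_of_nonneg_right ?_ ?_) hρ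
      · linarith
      · linarith
    -- The requirement is `y * (0.6 - 0.5115 * y) ≥ 0.5115 * y - 0.4885`. The difference is concave
    -- in `y` and positive at both ends of `[0, 1]`, with `0.0655` left at `y = 1`.
    rw [beta_mul_rho hβ (le_trans (by nlinarith) hρ'), hα]
    ring
  · have : alpha P 0.0115 x i t = (0.5 + 0.0115) / (1 - (0.5 + 0.0115) * P.load x i t) :=
      (min_choice _ _).resolve_left hα
    rw [this, div_mul_cancel₀ _ hw.ne', add_zero]

/-- The induction closes because an allocation rate of `0.5115 * x` removes `0.5115 * x * q` of
availability, exactly the growth of the scaled load. -/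
theorem expect_avail (hx : P.LPFeasible x) (i : I) : ∀ n ≤ T,
    (expect (run P PS 0.0115 x n) fun h => if i ∈ availBefore h n then 1 else 0) =
      1 - (0.5 + 0.0115) * P.loadBefore x i n
  | 0, _ => by simp [run, expect_pure, availBefore, Problem.loadBefore_zero]
  | n + 1, hn => by
    obtain ⟨t, rfl⟩ : ∃ t : Fin T, n = t := ⟨⟨n, hn⟩, rfl⟩
    have ih := expect_avail hx i t (by omega)
    simp only [← avail_eq_availBefore] at ih
    rw [← Problem.load_eq_loadBefore] at ih
    have ha := expect_alloc_of_avail hx t i ih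
    rw [P.loadBefore_succ, ← Problem.load_eq_loadBefore, mul_add, ← mul_assoc, ← ha, ← sub_sub,
      ← ih, expect_run_succ, mul_assoc, mul_comm _ (P.q i t), ← expect_mul_left,
      ← expect_mul_left, ← expect_sub]
    refine expect_congr fun h hh => ?_
    rw [expect_arrivalRound_avail hx, availBefore_succ_of_mem_support hh]
    ring

theorem expect_alloc (hx : P.LPFeasible x) (t : Fin T) (i : I) :
    P.p t * (expect (run P PS 0.0115 x t) fun h => expect (firstAlloc P PS 0.0115 x h t) fun A =>
      expect (secondAlloc P PS 0.0115 x (run P PS 0.0115 x t) h t A) fun B =>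
        if i ∈ A ∪ B then 1 else 0) = (0.5 + 0.0115) * x i t := by
  refine expect_alloc_of_avail hx t i ?_
  rw [Problem.load_eq_loadBefore, ← expect_avail (PS := PS) hx i t t.2.le]
  simp only [avail_eq_availBefore]

theorem allocProb_eq (hx : P.LPFeasible x) (t : Fin T) (i : I) :
    allocProb P PS 0.0115 x i t = (0.5 + 0.0115) * x i t := by
  have h : allocProb P PS 0.0115 x i t =
      expect (run P PS 0.0115 x T) fun h => if i ∈ (h t).1 then 1 else 0 := by
    unfold allocProb prob
    congr! 3
  rw [h, expect_run_of_le t (fun w => if i ∈ w.1 then 1 else 0) t.2 le_rfl,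
    expect_run_succ_record t (fun w => if i ∈ w.1 then 1 else 0) (by simp),
    ← expect_alloc (PS := PS) hx]
  exact congrArg _ (expect_congr fun h _ => expect_congr fun A _ => expect_congr fun B _ =>
    expect_const _ (if i ∈ A ∪ B then (1 : ℝ) else 0))

theorem expectedWelfare_eq (hx : P.LPFeasible x) :
    expectedWelfare P PS 0.0115 x = (0.5 + 0.0115) * P.lpValue x := by
  have e : ∀ t i, (expect (run P PS 0.0115 x T) fun h => if i ∈ (h t).2 then 1 else 0) =
      P.q i t * ((0.5 + 0.0115) * x i t) := by
    intro t i
    rw [expect_run_of_le t (fun w => if i ∈ w.2 then 1 else 0) t.2 le_rfl,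
      expect_run_succ_record t (fun w => if i ∈ w.2 then 1 else 0) (by simp),
      ← expect_alloc (PS := PS) hx, mul_left_comm, ← expect_mul_left]
    simp only [← expect_mul_left]
    refine expect_congr fun h _ => expect_congr fun A _ => expect_congr fun B _ => ?_
    rw [expect_mul_left]
    refine congrArg _ ?_
    refine (expect_thin_mem (A ∪ B) (fun k _ => P.q_nonneg k t)
      (fun k _ => P.q_le_one k t) i).trans ?_
    simp
  have e2 : ∀ (h : History I T) (t : Fin T), ∑ i ∈ (h t).2, P.v i t =
      ∑ i, P.v i t * if i ∈ (h t).2 then 1 else 0 := by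
    intro h t; simp
  simp only [expectedWelfare, e2, expect_sum, expect_mul_left, e]
  rw [Finset.sum_comm, Problem.lpValue, Finset.mul_sum]
  refine Finset.sum_congr rfl fun i _ => ?_
  rw [Finset.mul_sum]
  exact Finset.sum_congr rfl fun t _ => by ring

end Algorithm

/-! ### The linear program bounds the optimal online welfare -/

namespace Problem

variable {I : Type*} [Fintype I] [DecidableEq I] {T : ℕ} (P : Problem I T)

/-- The expected gain of the choice `J'` for `t` when the users in `J` are available, followed by
optimal play. -/
def choiceGain (t : Fin T) (J J' : Finset I) : ℝ :=
  expect (thin (fun i => P.q i t) J') fun S => (∑ i ∈ S, P.v i t) + P.optFrom (t + 1) (J \ S)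

theorem exists_bestChoice (t : Fin T) (J : Finset I) : ∃ J' ∈ P.choices t J,
    (P.choices t J).sup' (P.choices_nonempty t J) (P.choiceGain t J) = P.choiceGain t J J' :=
  Finset.exists_mem_eq_sup' _ _

/-- A choice of the optimal online algorithm. -/
def bestChoice (t : Fin T) (J : Finset I) : Finset I := (P.exists_bestChoice t J).choose

theorem bestChoice_subset (t : Fin T) (J : Finset I) : P.bestChoice t J ⊆ J := by
  have h := (P.exists_bestChoice t J).choose_spec.1
  exact Finset.mem_powerset.1 (Finset.mem_filter.1 h).1

theorem card_bestChoice_le (t : Fin T) (J : Finset I) : (P.bestChoice t J).card ≤ P.c t := by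
  have h := (P.exists_bestChoice t J).choose_spec.1
  exact (Finset.mem_filter.1 h).2

theorem optFrom_eq (t : Fin T) (J : Finset I) : P.optFrom t J =
    (1 - P.p t) * P.optFrom (t + 1) J + P.p t * P.choiceGain t J (P.bestChoice t J) := by
  rw [bestChoice, ← (P.exists_bestChoice t J).choose_spec.2, optFrom, dif_pos t.2]
  rfl

/-- The law of the set of available users after `n` rounds of the optimal online algorithm. -/
def optAvail : ℕ → PMF (Finset I)
  | 0 => PMF.pure Finset.univ
  | n + 1 =>
    if hn : n < T then
      (optAvail n).bind fun J => (coin (P.p ⟨n, hn⟩)).bind fun arrives =>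
        if arrives then (thin (fun i => P.q i ⟨n, hn⟩) (P.bestChoice ⟨n, hn⟩ J)).bind fun S =>
          PMF.pure (J \ S) else PMF.pure J
    else optAvail n

theorem expect_optAvail_succ (t : Fin T) (f : Finset I → ℝ) :
    expect (P.optAvail (t + 1)) f = expect (P.optAvail t) fun J => (1 - P.p t) * f J +
      P.p t * expect (thin (fun i => P.q i t) (P.bestChoice t J)) fun S => f (J \ S) := by
  rw [optAvail, dif_pos t.2, expect_bind]
  congr 1
  funext J
  rw [expect_coin_bind (P.p_nonneg t) (P.p_le_one t), expect_pure, expect_bind]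
  simp only [expect_pure]
  ring

/-- The probabilities with which the optimal online algorithm chooses `i` for `t`. -/
def optMarginal (i : I) (t : Fin T) : ℝ :=
  P.p t * expect (P.optAvail t) fun J => if i ∈ P.bestChoice t J then 1 else 0

theorem expect_optAvail_mem (i : I) : ∀ n ≤ T,
    (expect (P.optAvail n) fun J => if i ∈ J then 1 else 0) =
      1 - P.loadBefore P.optMarginal i n
  | 0, _ => by simp [optAvail, expect_pure, loadBefore_zero]
  | n + 1, hn => by
    obtain ⟨t, rfl⟩ : ∃ t : Fin T, n = t := ⟨⟨n, hn⟩, rfl⟩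
    rw [P.loadBefore_succ, ← sub_sub, ← expect_optAvail_mem i t (by omega), optMarginal,
      mul_right_comm, ← expect_mul_left, ← expect_sub, expect_optAvail_succ]
    congr 1
    funext J
    by_cases hi : i ∈ J
    · have := expect_thin_notMem (P.bestChoice t J) (fun k _ => P.q_nonneg k t)
        (fun k _ => P.q_le_one k t) i
      simp only [Finset.mem_sdiff, hi, true_and, ite_not, if_true]
      rw [this]
      split_ifs <;> ring
    · have : i ∉ P.bestChoice t J := fun h => hi (P.bestChoice_subset t J h)
      simp [hi, this, expect_const]

/-- The choice for `t` depends on the past, which is independent of the arrival of `t`, and uses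
only available users. Hence the conditional choice probability is at most the availability `1 - y`.
-/
theorem lpFeasible_optMarginal : P.LPFeasible P.optMarginal := by
  refine ⟨fun t => ?_, fun i t => ⟨?_, ?_⟩⟩
  · simp only [optMarginal]
    rw [← Finset.mul_sum, ← expect_sum]
    refine mul_le_mul_of_nonneg_left ?_ (P.p_nonneg t)
    refine (expect_mono fun J _ => ?_).trans (expect_const (P.optAvail t) (P.c t : ℝ)).le
    rw [Finset.sum_boole, Finset.filter_mem_eq_inter, Finset.univ_inter]
    exact_mod_cast P.card_bestChoice_le t J
  · exact mul_nonneg (P.p_nonneg t) (expect_nonneg fun J => by split_ifs <;> norm_num)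
  · rw [load_eq_loadBefore, ← P.expect_optAvail_mem i t t.2.le]
    refine mul_le_mul_of_nonneg_left (expect_mono fun J _ => ?_) (P.p_nonneg t)
    by_cases h : i ∈ P.bestChoice t J
    · simp [h, P.bestChoice_subset t J h]
    · simp only [h, if_false]; split_ifs <;> norm_num

theorem choiceGain_eq (t : Fin T) (J J' : Finset I) : P.choiceGain t J J' =
    (∑ i, P.q i t * P.v i t * if i ∈ J' then 1 else 0) +
      expect (thin (fun i => P.q i t) J') fun S => P.optFrom (t + 1) (J \ S) := by
  rw [choiceGain, expect_add]
  congr 1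
  have e : ∀ S : Finset I, ∑ i ∈ S, P.v i t = ∑ i, P.v i t * if i ∈ S then 1 else 0 := by
    intro S; simp
  simp only [e, expect_sum, expect_mul_left,
    expect_thin_mem _ (fun k _ => P.q_nonneg k t) (fun k _ => P.q_le_one k t)]
  exact Finset.sum_congr rfl fun i _ => by split_ifs <;> ring

theorem expect_optFrom (t : Fin T) : expect (P.optAvail t) (P.optFrom t) =
    (∑ i, P.optMarginal i t * P.q i t * P.v i t) +
      expect (P.optAvail (t + 1)) (P.optFrom (t + 1)) := by
  have e : ∀ i, P.optMarginal i t * P.q i t * P.v i t = expect (P.optAvail t) fun J =>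
      P.p t * (P.q i t * P.v i t * if i ∈ P.bestChoice t J then 1 else 0) := by
    intro i
    rw [expect_mul_left, expect_mul_left, optMarginal]
    ring
  simp only [e]
  rw [← expect_sum, expect_optAvail_succ, ← expect_add]
  congr 1
  funext J
  rw [optFrom_eq, choiceGain_eq, ← Finset.mul_sum]
  ring

/-- The Bellman equation telescopes along the optimal run: gains collected so far plus the expected
value-to-go stay constant. -/
theorem optOn_eq_lpValue : P.optOn = P.lpValue P.optMarginal := by
  have h : ∀ n ≤ T, P.optOn = (∑ t ∈ Finset.univ.filter fun t : Fin T => (t : ℕ) < n,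
      ∑ i, P.optMarginal i t * P.q i t * P.v i t) + expect (P.optAvail n) (P.optFrom n) := by
    intro n
    induction n with
    | zero => intro _; simp [optAvail, expect_pure, optOn]
    | succ n ih =>
      intro hn
      obtain ⟨t, rfl⟩ : ∃ t : Fin T, n = t := ⟨⟨n, hn⟩, rfl⟩
      have e : (Finset.univ.filter fun t' : Fin T => (t' : ℕ) < t + 1) =
          insert t (Finset.univ.filter fun t' : Fin T => (t' : ℕ) < t) := by
        ext t'
        simp only [Finset.mem_filter, Finset.mem_univ, true_and, Finset.mem_insert, Fin.ext_iff]
        omega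
      rw [ih (by omega), e, Finset.sum_insert (by simp), expect_optFrom]
      ring
  have h0 : ∀ J, P.optFrom T J = 0 := fun J => by rw [optFrom, dif_neg (lt_irrefl T)]
  rw [h T le_rfl, lpValue, Finset.sum_comm]
  simp [funext h0, expect_const]

end Problem

end

end CapacitatedAllocation

theorem theorem4p1 {I : Type*} [Fintype I] [DecidableEq I] {T : ℕ}
    (P : CapacitatedAllocation.Problem I T)
    (PS : CapacitatedAllocation.PivotalSampler I)
    (x : I → Fin T → ℝ) (hx : P.LPOptimal x) :
    (0.5 + 0.0115) * P.optOn ≤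
        CapacitatedAllocation.Algorithm.expectedWelfare P PS 0.0115 x ∧
      ∀ (i : I) (t : Fin T),
        CapacitatedAllocation.Algorithm.allocProb P PS 0.0115 x i t =
          (0.5 + 0.0115) * x i t := by
  have h := CapacitatedAllocation.Algorithm.expectedWelfare_eq (PS := PS) hx.1
  refine ⟨?_, fun i t => CapacitatedAllocation.Algorithm.allocProb_eq hx.1 t i⟩
  rw [h, P.optOn_eq_lpValue]
  exact mul_le_mul_of_nonneg_left (hx.2 _ P.lpFeasible_optMarginal) (by norm_num)
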